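/- Let $\Bbbk$ be an algebraically closed field of characteristic zero, $\Bbbk^*=\Bbbk\setminus\{0\}$, and let $q\in\Bbbk^*$ be not a root of unity. Let $D_q$ be the Heisenberg double of the quantum Euclidean group, i.e. the $\Bbbk$-algebra generated by $a,a^{-1},b,c,K,K^{-1},E,F$ subject to the defining relations $$\begin{aligned} &ab=qba,\quad ac=qca,\quad bc=cb,\quad aa^{-1}=a^{-1}a=1,\\ &KE=q^2EK,\quad KF=q^{-2}FK,\quad EF=FE,\quad KK^{-1}=K^{-1}K=1,\\ &Ka=q^{-1}aK,\quad Kb=qbK,\quad Kc=q^{-1}cK,\\ &Ea=aE,\quad Eb=bE,\quad Ec=cE+a^{-1}K,\\ &Fa=qaF,\quad Fb=q^{-1}bF+a,\quad Fc=qcF. \end{aligned}$$ Modules are left modules. For a $D_q$-module $V$ and $\mu\in\Bbbk^*$ put $V_\mu=\{v\in V\mid av=\mu v\}$ and $\operatorname{supp}_a(V)=\{\mu\in\Bbbk^*\mid V_\mu\neq 0\}$; $V$ is an $a$-weight module if $V=\bigoplus_{\mu\in\Bbbk^*}V_\mu$. For $x\in D_q$ let $C(x,D_q)=\{d\in D_q\mid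 dx=xd\}$, and put $\mathscr A=C(a,D_q)$. Let $\tau_K$ be the automorphism $t\mapsto K^{-1}tK$ of $\mathscr A$. For an automorphism $\sigma$ of $\mathscr A$ and an $\mathscr A$-module $M$, let $M^{\sigma}$ be the abelian group $M$ on which $t\in\mathscr A$ acts as $\sigma(t)$. 1. Let $V$ be a simple $a$-weight $D_q$-module. Then $\operatorname{supp}_a(V)$ is non-empty, $\operatorname{supp}_a(V)=\{q^i\mu\mid i\in\mathbb Z\}$ for every $\mu\in\operatorname{supp}_a(V)$, and $V_\mu$ is infinite-dimensional over $\Bbbk$ for every $\mu\in\operatorname{supp}_a(V)$. 2. The $\Bbbk$-algebras $\mathscr A=C(a,D_q)$ and $C(K,D_q)$ are isomorphic. 3. The assignment $M\mapsto \operatorname{ind}(M):=D_q\otimes_{\mathscr A}M$ defines a surjection from the set of isomorphism classes of simple $\mathscr A$-modules onto the set of isomorphism classes of simple $a$-weight $D_q$-modules: $\operatorname{ind}(M)$ is a simple $a$-weight $D_q$-module for every simple $\mathscr A$-module $M$, and every simple $a$-weight $D_q$-module is isomorphic to $\operatorname{ind}(M)$ for some simple $\mathscr A$-module $M$. Moreover,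 for simple $\mathscr A$-modules $M,M'$, one has $\operatorname{ind}(M)\simeq\operatorname{ind}(M')$ as $D_q$-modules if and only if $M'\simeq M^{\tau_K^i}$ as $\mathscr A$-modules for some $i\in\mathbb Z$. -/

import Mathlib

open scoped TensorProduct

universe u v

namespace HeisenbergDouble

/-- The eight generators `a, a⁻¹, b, c, K, K⁻¹, E, F`. -/
inductive Gen : Type
  | a | ainv | b | c | K | Kinv | E | F

section Algebra

variable (k : Type u) [Field k] (q : kˣ)

/-- A generator, as an element of the free algebra. -/
abbrev gen (x : Gen) : FreeAlgebra k Gen := FreeAlgebra.ι k x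

/-- The defining relations of `D_q(E₂)`. -/
inductive Rel : FreeAlgebra k Gen → FreeAlgebra k Gen → Prop
  | ab : Rel (gen k .a * gen k .b) ((q : k) • (gen k .b * gen k .a))
  | ac : Rel (gen k .a * gen k .c) ((q : k) • (gen k .c * gen k .a))
  | bc : Rel (gen k .b * gen k .c) (gen k .c * gen k .b)
  | a_ainv : Rel (gen k .a * gen k .ainv) 1
  | ainv_a : Rel (gen k .ainv * gen k .a) 1
  | KE : Rel (gen k .K * gen k .E) (((q ^ 2 : kˣ) : k) • (gen k .E * gen k .K))
  | KF : Rel (gen k .K * gen k .F) (((q ^ (-2 : ℤ) : kˣ) : k) • (gen k .F * gen k .K))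
  | EF : Rel (gen k .E * gen k .F) (gen k .F * gen k .E)
  | K_Kinv : Rel (gen k .K * gen k .Kinv) 1
  | Kinv_K : Rel (gen k .Kinv * gen k .K) 1
  | Ka : Rel (gen k .K * gen k .a) (((q⁻¹ : kˣ) : k) • (gen k .a * gen k .K))
  | Kb : Rel (gen k .K * gen k .b) ((q : k) • (gen k .b * gen k .K))
  | Kc : Rel (gen k .K * gen k .c) (((q⁻¹ : kˣ) : k) • (gen k .c * gen k .K))
  | Ea : Rel (gen k .E * gen k .a) (gen k .a * gen k .E)
  | Eb : Rel (gen k .E * gen k .b) (gen k .b * gen k .E)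
  | Ec : Rel (gen k .E * gen k .c) (gen k .c * gen k .E + gen k .ainv * gen k .K)
  | Fa : Rel (gen k .F * gen k .a) ((q : k) • (gen k .a * gen k .F))
  | Fb : Rel (gen k .F * gen k .b) (((q⁻¹ : kˣ) : k) • (gen k .b * gen k .F) + gen k .a)
  | Fc : Rel (gen k .F * gen k .c) ((q : k) • (gen k .c * gen k .F))

/-- The Heisenberg double `D_q = D_q(E₂)` of the quantum Euclidean group: the `k`-algebra
presented by the generators `Gen` and the relations `Rel`. -/
def Dq : Type u := RingQuot (Rel k q)

instance : Ring (Dq k q) := inferInstanceAs (Ring (RingQuot (Rel k q)))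

instance : Algebra k (Dq k q) := inferInstanceAs (Algebra k (RingQuot (Rel k q)))

/-- The image of a generator in `D_q`. -/
def Dq.of (x : Gen) : Dq k q := RingQuot.mkAlgHom k (Rel k q) (gen k x)

/-- The centralizer `C(x, D_q)` of an element `x` of `D_q`. -/
abbrev C (x : Dq k q) : Subalgebra k (Dq k q) := Subalgebra.centralizer k {x}

/-- The algebra `𝒜 = C(a, D_q)`. -/
abbrev CA : Subalgebra k (Dq k q) := C k q (Dq.of k q .a)

/-- The algebra `𝒞 = C(K, D_q)`. -/
abbrev CK : Subalgebra k (Dq k q) := C k q (Dq.of k q .K)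

theorem Dq.K_mul_Kinv : Dq.of k q .K * Dq.of k q .Kinv = 1 := by
  have h := RingQuot.mkAlgHom_rel k (Rel.K_Kinv (k := k) (q := q))
  rw [map_mul, map_one] at h
  exact h

theorem Dq.Kinv_mul_K : Dq.of k q .Kinv * Dq.of k q .K = 1 := by
  have h := RingQuot.mkAlgHom_rel k (Rel.Kinv_K (k := k) (q := q))
  rw [map_mul, map_one] at h
  exact h

theorem Dq.K_mul_a :
    Dq.of k q .K * Dq.of k q .a = ((q⁻¹ : kˣ) : k) • (Dq.of k q .a * Dq.of k q .K) := by
  have h := RingQuot.mkAlgHom_rel k (Rel.Ka (k := k) (q := q))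
  rw [map_smul, map_mul, map_mul] at h
  exact h

theorem Dq.conj_a :
    (Dq.of k q .K) * Dq.of k q .a * Dq.of k q .Kinv = ((q⁻¹ : kˣ) : k) • Dq.of k q .a := by
  rw [Dq.K_mul_a, smul_mul_assoc, mul_assoc, Dq.K_mul_Kinv, mul_one]

theorem Dq.conj_a' :
    (Dq.of k q .Kinv) * Dq.of k q .a * Dq.of k q .K = (q : k) • Dq.of k q .a := by
  have h : Dq.of k q .a * Dq.of k q .K = (q : k) • (Dq.of k q .K * Dq.of k q .a) := by
    rw [Dq.K_mul_a, smul_smul, Units.mul_inv, one_smul]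
  rw [mul_assoc, h, mul_smul_comm, ← mul_assoc, Dq.Kinv_mul_K, one_mul]

theorem CA_conj_mem {t : Dq k q} (ht : t ∈ CA k q) :
    Dq.of k q .Kinv * t * Dq.of k q .K ∈ CA k q := by
  rw [Subalgebra.mem_centralizer_iff] at ht ⊢
  intro g hg
  rw [Set.mem_singleton_iff] at hg
  subst hg
  have h := ht _ rfl
  have h1 := Dq.K_mul_Kinv k q
  have h2 := Dq.Kinv_mul_K k q
  have hc := Dq.conj_a k q
  have e1 : Dq.of k q .a * (Dq.of k q .Kinv * t * Dq.of k q .K)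
      = Dq.of k q .Kinv * (Dq.of k q .K * Dq.of k q .a * Dq.of k q .Kinv) * t * Dq.of k q .K := by
    calc _ = (Dq.of k q .Kinv * Dq.of k q .K) * Dq.of k q .a *
          (Dq.of k q .Kinv * t * Dq.of k q .K) := by rw [h2, one_mul]
      _ = _ := by noncomm_ring
  have e2 : Dq.of k q .Kinv * t * Dq.of k q .K * Dq.of k q .a
      = Dq.of k q .Kinv * t * (Dq.of k q .K * Dq.of k q .a * Dq.of k q .Kinv) * Dq.of k q .K := by
    calc _ = Dq.of k q .Kinv * t * Dq.of k q .K * Dq.of k q .a *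
          (Dq.of k q .Kinv * Dq.of k q .K) := by rw [h2, mul_one]
      _ = _ := by noncomm_ring
  rw [e1, e2, hc, mul_smul_comm, mul_smul_comm, smul_mul_assoc, smul_mul_assoc, smul_mul_assoc,
    mul_assoc (Dq.of k q .Kinv), h, ← mul_assoc]

theorem CA_conj_mem' {t : Dq k q} (ht : t ∈ CA k q) :
    Dq.of k q .K * t * Dq.of k q .Kinv ∈ CA k q := by
  rw [Subalgebra.mem_centralizer_iff] at ht ⊢
  intro g hg
  rw [Set.mem_singleton_iff] at hg
  subst hg
  have h := ht _ rfl
  have h1 := Dq.K_mul_Kinv k q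
  have hc := Dq.conj_a' k q
  have e1 : Dq.of k q .a * (Dq.of k q .K * t * Dq.of k q .Kinv)
      = Dq.of k q .K * (Dq.of k q .Kinv * Dq.of k q .a * Dq.of k q .K) * t * Dq.of k q .Kinv := by
    calc _ = (Dq.of k q .K * Dq.of k q .Kinv) * Dq.of k q .a *
          (Dq.of k q .K * t * Dq.of k q .Kinv) := by rw [h1, one_mul]
      _ = _ := by noncomm_ring
  have e2 : Dq.of k q .K * t * Dq.of k q .Kinv * Dq.of k q .a
      = Dq.of k q .K * t * (Dq.of k q .Kinv * Dq.of k q .a * Dq.of k q .K) * Dq.of k q .Kinv := by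
    calc _ = Dq.of k q .K * t * Dq.of k q .Kinv * Dq.of k q .a *
          (Dq.of k q .K * Dq.of k q .Kinv) := by rw [h1, mul_one]
      _ = _ := by noncomm_ring
  rw [e1, e2, hc, mul_smul_comm, mul_smul_comm, smul_mul_assoc, smul_mul_assoc, smul_mul_assoc,
    mul_assoc (Dq.of k q .K), h, ← mul_assoc]

/-- The automorphism `τ_K : 𝒜 → 𝒜`, `t ↦ K⁻¹ t K`. -/
def tauK : CA k q ≃ₐ[k] CA k q where
  toFun t := ⟨Dq.of k q .Kinv * t * Dq.of k q .K, CA_conj_mem k q t.2⟩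
  invFun t := ⟨Dq.of k q .K * t * Dq.of k q .Kinv, CA_conj_mem' k q t.2⟩
  left_inv t := by
    apply Subtype.ext
    change Dq.of k q .K * (Dq.of k q .Kinv * t * Dq.of k q .K) * Dq.of k q .Kinv = t
    calc _ = (Dq.of k q .K * Dq.of k q .Kinv) * t * (Dq.of k q .K * Dq.of k q .Kinv) := by
          noncomm_ring
      _ = t := by rw [Dq.K_mul_Kinv, one_mul, mul_one]
  right_inv t := by
    apply Subtype.ext
    change Dq.of k q .Kinv * (Dq.of k q .K * t * Dq.of k q .Kinv) * Dq.of k q .K = t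
    calc _ = (Dq.of k q .Kinv * Dq.of k q .K) * t * (Dq.of k q .Kinv * Dq.of k q .K) := by
          noncomm_ring
      _ = t := by rw [Dq.Kinv_mul_K, one_mul, mul_one]
  map_mul' s t := by
    apply Subtype.ext
    change Dq.of k q .Kinv * (s * t : Dq k q) * Dq.of k q .K
      = (Dq.of k q .Kinv * s * Dq.of k q .K) * (Dq.of k q .Kinv * t * Dq.of k q .K)
    calc _ = Dq.of k q .Kinv * s * 1 * t * Dq.of k q .K := by noncomm_ring
      _ = Dq.of k q .Kinv * s * (Dq.of k q .K * Dq.of k q .Kinv) * t * Dq.of k q .K := by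
          rw [Dq.K_mul_Kinv]
      _ = _ := by noncomm_ring
  map_add' s t := by
    apply Subtype.ext
    change Dq.of k q .Kinv * (s + t : Dq k q) * Dq.of k q .K
      = Dq.of k q .Kinv * s * Dq.of k q .K + Dq.of k q .Kinv * t * Dq.of k q .K
    rw [mul_add, add_mul]
  commutes' r := by
    apply Subtype.ext
    change Dq.of k q .Kinv * algebraMap k (Dq k q) r * Dq.of k q .K = algebraMap k (Dq k q) r
    rw [← Algebra.commutes, mul_assoc, Dq.Kinv_mul_K, mul_one]

end Algebra

section Twist

/-- The twist `M^σ` of an `R`-module `M` by an automorphism `σ` of `R`: the same abelian group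
with `r` acting as `σ r`. -/
def Twist {k : Type*} [CommRing k] {R : Type*} [Ring R] [Algebra k R] (_σ : R ≃ₐ[k] R)
    (M : Type v) : Type v := M

variable {k : Type*} [CommRing k] {R : Type*} [Ring R] [Algebra k R] (σ : R ≃ₐ[k] R)
  (M : Type v) [AddCommGroup M] [Module R M]

instance : AddCommGroup (Twist σ M) := inferInstanceAs (AddCommGroup M)

instance : Module R (Twist σ M) := Module.compHom M (σ : R →+* R)

end Twist

section Induction

variable {k : Type u} [Field k] {D : Type u} [Ring D] [Algebra k D] (S : Subalgebra k D)
  (M : Type v) [AddCommGroup M] [Module S M]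

/-- The left `D`-submodule of `D ⊗_ℤ M` generated by all `d s ⊗ m - d ⊗ s m` with
`d ∈ D`, `s ∈ S`, `m ∈ M`. -/
def balancedRel : Submodule D (D ⊗[ℤ] M) :=
  Submodule.span D {x | ∃ (d : D) (s : S) (m : M), x = (d * (s : D)) ⊗ₜ[ℤ] m - d ⊗ₜ[ℤ] (s • m)}

/-- The induced left `D`-module `D ⊗_S M` (the tensor product over the noncommutative ring `S`). -/
def Ind : Type (max u v) := (D ⊗[ℤ] M) ⧸ balancedRel S M

instance : AddCommGroup (Ind S M) :=
  inferInstanceAs (AddCommGroup ((D ⊗[ℤ] M) ⧸ balancedRel S M))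

instance : Module D (Ind S M) :=
  inferInstanceAs (Module D ((D ⊗[ℤ] M) ⧸ balancedRel S M))

instance : Module k (Ind S M) :=
  inferInstanceAs (Module k ((D ⊗[ℤ] M) ⧸ balancedRel S M))

instance : IsScalarTower k D (Ind S M) :=
  inferInstanceAs (IsScalarTower k D ((D ⊗[ℤ] M) ⧸ balancedRel S M))

end Induction

section Weight

variable (k : Type u) [Field k] (q : kˣ) (V : Type v) [AddCommGroup V] [Module k V]
  [Module (Dq k q) V] [IsScalarTower k (Dq k q) V]

/-- The `a`-weight space `V_μ = {v ∈ V | a v = μ v}`. -/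
def weightSpace (μ : kˣ) : Submodule k V :=
  Module.End.eigenspace (Algebra.lsmul k k V (Dq.of k q .a)) (μ : k)

theorem mem_weightSpace (μ : kˣ) (x : V) :
    x ∈ weightSpace k q V μ ↔ Dq.of k q .a • x = (μ : k) • x :=
  Module.End.mem_eigenspace_iff

/-- `V` is an `a`-weight module: `V` is the direct sum of the `V_μ`, `μ ∈ kˣ`. -/
def IsAWeight : Prop :=
  open scoped Classical in DirectSum.IsInternal (weightSpace k q V)

/-- The `a`-support of `V`. -/
def supp : Set kˣ := {μ | weightSpace k q V μ ≠ ⊥}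

end Weight

end HeisenbergDouble

open HeisenbergDouble

/-!
`D_q` is the algebra of the quantum torus `⟨a, K⟩` and of the four elements `e = E a²`,
`y = c K⁻¹ a⁻¹`, `z = b K⁻¹ a`, `f = F K a⁻²`, which commute with the torus and satisfy quantum Weyl
relations among themselves. The rotation `a ↦ K`, `K ↦ a⁻¹` of the torus is therefore an
automorphism of `D_q`, and it exchanges the two centralizers. Conjugation by `a` grades `D_q`, with
degree zero part `𝒜 = C(a, D_q)` and `D_q = ⨁ⱼ 𝒜 Kʲ`, so that `𝒜` is generated by `a`, `a⁻¹`, `e`,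
`y`, `z`, `f`.

Over `k[a]` the algebra `𝒜` is generically free, so by Quillen's argument the central element `a`
acts on a simple `𝒜`-module as a scalar. No nonzero `𝒜`-module is finite-dimensional: there `e` and
`f` would be invertible, since the spectrum of `y e` would otherwise contain an infinite orbit, and
`e f = q⁻² f e` contradicts multiplicativity of the determinant. Finally `M ↦ D_q ⊗ M` and
`V ↦ V_μ` are mutually inverse for `M` of weight `μ`, and the weight space of `D_q ⊗ M` of weight
`qⁱ μ` is `Kⁱ ⊗ M`, the twist of `M` by `τ_Kⁱ`.
-/

namespace HeisenbergDouble

section QCommute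

/-- `x` and `y` commute up to the scalar `s`, that is `x y = s y x`. The scalar is a unit, so that
the relation can be turned around. -/
def QCommute {k A : Type*} [CommRing k] [Ring A] [Algebra k A] (s : kˣ) (x y : A) : Prop :=
  x * y = s • (y * x)

namespace QCommute

variable {k A : Type*} [CommRing k] [Ring A] [Algebra k A] {s t r p : kˣ} {x x' y z w v v' : A}

theorem of_commute (h : Commute x y) : QCommute (1 : kˣ) x y := by
  rw [QCommute, one_smul, h.eq]

theorem cast (h : QCommute s x y) (hst : s = t) : QCommute t x y := hst ▸ h

theorem commute (h : QCommute s x y) (hs : s = 1) : Commute x y := by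
  rwa [QCommute, hs, one_smul] at h

theorem symm (h : QCommute s x y) : QCommute s⁻¹ y x := by
  rw [QCommute, h, inv_smul_smul]

theorem mul_left (hx : QCommute s x z) (hy : QCommute t y z) : QCommute (s * t) (x * y) z := by
  rw [QCommute, mul_assoc, hy, mul_smul_comm, ← mul_assoc, hx, smul_mul_assoc, smul_smul,
    mul_comm t, mul_assoc z]

theorem mul_right (hy : QCommute s x y) (hz : QCommute t x z) : QCommute (s * t) x (y * z) := by
  rw [QCommute, ← mul_assoc, hy, smul_mul_assoc, mul_assoc, hz, mul_smul_comm, smul_smul,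
    mul_assoc]

theorem units_inv_left {a : Aˣ} (h : QCommute s (a : A) x) : QCommute s⁻¹ (↑a⁻¹ : A) x := by
  rw [QCommute, Units.inv_mul_eq_iff_eq_mul, mul_smul_comm, ← mul_assoc, h, smul_mul_assoc,
    inv_smul_smul, Units.mul_inv_cancel_right]

theorem units_inv_right {a : Aˣ} (h : QCommute s x (a : A)) : QCommute s⁻¹ x (↑a⁻¹ : A) :=
  h.symm.units_inv_left.symm

theorem units_zpow_left {a : Aˣ} (h : QCommute s (a : A) x) (n : ℤ) :
    QCommute (s ^ n) (↑(a ^ n) : A) x := by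
  induction n with
  | zero => simpa using of_commute (Commute.one_left x)
  | succ n ih => rw [zpow_add_one, zpow_add_one, Units.val_mul]; exact ih.mul_left h
  | pred n ih => rw [zpow_sub_one, zpow_sub_one, Units.val_mul]; exact ih.mul_left h.units_inv_left

theorem map {B : Type*} [Ring B] [Algebra k B] (φ : A →ₐ[k] B) (h : QCommute s x y) :
    QCommute s (φ x) (φ y) := by
  rw [QCommute, ← map_mul, h, Units.smul_def, map_smul, map_mul, Units.smul_def]

theorem mul_mul_mul_of_mul_eq_smul_add (hx : x * x' = s • (x' * x) + w) (hx' : QCommute t v x')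
    (hv : QCommute r x v') (hvv' : QCommute p v v') :
    x * v * (x' * v') = (t * s * p * r) • (x' * v' * (x * v)) + t • (w * v * v') := by
  have hpr : x * (v * v') = (p * r) • (v' * (x * v)) := by
    rw [hvv', mul_smul_comm, ← mul_assoc, hv, smul_mul_assoc, smul_smul, mul_assoc]
  calc x * v * (x' * v') = t • (x * x' * (v * v')) := by
        rw [mul_assoc, ← mul_assoc v, hx', smul_mul_assoc, mul_smul_comm, mul_assoc, mul_assoc]
    _ = t • (s • (x' * (x * (v * v'))) + w * v * v') := by
        rw [hx, add_mul, smul_mul_assoc, mul_assoc x', mul_assoc w]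
    _ = _ := by
        rw [hpr, mul_smul_comm, smul_add, smul_smul, smul_smul, mul_assoc x', mul_assoc (t * s)]

end QCommute

/-- The monomial `aᵐ Kⁿ` in two units. -/
def torusMonomial {A : Type*} [Monoid A] (a K : Aˣ) (m n : ℤ) : Aˣ := a ^ m * K ^ n

theorem torusMonomial_mul_torusMonomial {k A : Type*} [CommRing k] [Ring A] [Algebra k A] {q : kˣ}
    {a K : Aˣ} (haK : QCommute q (a : A) (K : A)) (m n i j : ℤ) :
    (↑(torusMonomial a K m n * torusMonomial a K i j) : A)
      = q ^ (-(n * i)) • ↑(torusMonomial a K (m + i) (n + j)) := by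
  have hKa : QCommute (q ^ (-(n * i))) (↑(K ^ n) : A) (↑(a ^ i) : A) :=
    ((haK.symm.units_zpow_left n).symm.units_zpow_left i).symm.cast (by
      rw [← zpow_neg, ← inv_zpow', inv_inv]; group)
  simp only [torusMonomial, zpow_add, Units.val_mul]
  rw [mul_assoc, ← mul_assoc (↑(K ^ n) : A), hKa, smul_mul_assoc, mul_smul_comm]
  simp only [mul_assoc]

/-- `x` commutes with `a` and with `K` up to the same powers of `q` as the monomial `aᵐ Kⁿ` of the
quantum torus `a K = q K a`. -/
structure HasTorusDegree {k A : Type*} [CommRing k] [Ring A] [Algebra k A] (q : kˣ) (a K : Aˣ)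
    (m n : ℤ) (x : A) : Prop where
  left : QCommute (q ^ n) (a : A) x
  right : QCommute (q ^ (-m)) (K : A) x

namespace HasTorusDegree

variable {k A : Type*} [CommRing k] [Ring A] [Algebra k A] {q : kˣ} {a K : Aˣ} {x y : A}
  {r : k} {m n i j s : ℤ}

theorem of_commute (ha : Commute (a : A) x) (hK : Commute (K : A) x) :
    HasTorusDegree q a K 0 0 x where
  left := (QCommute.of_commute ha).cast (by group)
  right := (QCommute.of_commute hK).cast (by group)

theorem commute_left (h : HasTorusDegree q a K 0 0 x) : Commute (a : A) x :=
  h.left.commute (zpow_zero q)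

theorem commute_right (h : HasTorusDegree q a K 0 0 x) : Commute (K : A) x :=
  h.right.commute (zpow_zero q)

theorem torusMonomial_qcommute (hx : HasTorusDegree q a K m n x) (i j : ℤ) :
    QCommute (q ^ (i * n - j * m)) (torusMonomial a K i j : A) x := by
  rw [torusMonomial, Units.val_mul]
  refine ((hx.left.units_zpow_left i).mul_left (hx.right.units_zpow_left j)).cast ?_
  rw [← zpow_mul, ← zpow_mul, ← zpow_add]
  ring_nf

theorem of_torusMonomial (haK : QCommute q (a : A) (K : A)) (m n : ℤ) :
    HasTorusDegree q a K m n (torusMonomial a K m n : A) where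
  left := by
    have ha : HasTorusDegree q a K 1 0 (a : A) :=
      ⟨(QCommute.of_commute (Commute.refl _)).cast (by group), haK.symm.cast (by group)⟩
    exact (ha.torusMonomial_qcommute m n).symm.cast (by group)
  right := by
    have hK : HasTorusDegree q a K 0 1 (K : A) :=
      ⟨haK.cast (by group), (QCommute.of_commute (Commute.refl _)).cast (by group)⟩
    exact (hK.torusMonomial_qcommute m n).symm.cast (by group)

theorem mul (hx : HasTorusDegree q a K m n x) (hy : HasTorusDegree q a K i j y) :
    HasTorusDegree q a K (m + i) (n + j) (x * y) where
  left := (hx.left.mul_right hy.left).cast (by group)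
  right := (hx.right.mul_right hy.right).cast (by group)

theorem units_inv {v : Aˣ} (hv : HasTorusDegree q a K m n (v : A)) :
    HasTorusDegree q a K (-m) (-n) (↑v⁻¹ : A) where
  left := hv.left.units_inv_right.cast (by group)
  right := hv.right.units_inv_right.cast (by group)

theorem mul_torusMonomial (haK : QCommute q (a : A) (K : A)) (hx : HasTorusDegree q a K 0 0 x)
    (m n : ℤ) : HasTorusDegree q a K m n (x * torusMonomial a K m n) := by
  simpa only [zero_add] using hx.mul (of_torusMonomial haK m n)

theorem mul_inv_torusMonomial (haK : QCommute q (a : A) (K : A))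
    (hx : HasTorusDegree q a K m n x) :
    HasTorusDegree q a K 0 0 (x * ↑(torusMonomial a K m n)⁻¹) := by
  simpa only [add_neg_cancel] using hx.mul (of_torusMonomial haK m n).units_inv

theorem mul_torusMonomial_mul (haK : QCommute q (a : A) (K : A))
    (hx : HasTorusDegree q a K 0 0 x) (hy : HasTorusDegree q a K 0 0 y)
    (hxy : x * y = q ^ s • (y * x) + r • 1) (m n i j : ℤ) :
    x * torusMonomial a K m n * (y * torusMonomial a K i j)
      = q ^ (s + (m * j - n * i)) •
          (y * torusMonomial a K i j * (x * torusMonomial a K m n))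
        + r • ↑(torusMonomial a K m n * torusMonomial a K i j) := by
  rw [QCommute.mul_mul_mul_of_mul_eq_smul_add hxy (hy.torusMonomial_qcommute m n)
    (hx.torusMonomial_qcommute i j).symm ((of_torusMonomial haK i j).torusMonomial_qcommute m n)]
  simp only [mul_zero, sub_zero, zpow_zero, one_mul, inv_one, mul_one, one_smul, zpow_add,
    smul_mul_assoc, Units.val_mul]

theorem qcommute_mul_torusMonomial (haK : QCommute q (a : A) (K : A))
    (hx : HasTorusDegree q a K 0 0 x) (hy : HasTorusDegree q a K 0 0 y)
    (hxy : QCommute (q ^ s) x y) (m n i j : ℤ) :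
    QCommute (q ^ (s + (m * j - n * i))) (x * torusMonomial a K m n)
      (y * torusMonomial a K i j) := by
  have h := mul_torusMonomial_mul haK hx hy (r := 0) (by rw [hxy, zero_smul, add_zero]) m n i j
  rwa [zero_smul, add_zero] at h

theorem mul_inv_torusMonomial_mul (haK : QCommute q (a : A) (K : A))
    (hx : HasTorusDegree q a K m n x) (hy : HasTorusDegree q a K i j y)
    (hxy : x * y = q ^ s • (y * x) + r • ↑(torusMonomial a K i j * torusMonomial a K m n)) :
    x * ↑(torusMonomial a K m n)⁻¹ * (y * ↑(torusMonomial a K i j)⁻¹)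
      = q ^ (s - (m * j - n * i)) •
          (y * ↑(torusMonomial a K i j)⁻¹ * (x * ↑(torusMonomial a K m n)⁻¹))
        + q ^ (n * i - m * j) • r • 1 := by
  rw [QCommute.mul_mul_mul_of_mul_eq_smul_add hxy (hy.torusMonomial_qcommute m n).units_inv_left
    (hx.torusMonomial_qcommute i j).symm.units_inv_right
    ((of_torusMonomial haK i j).torusMonomial_qcommute m n).units_inv_left.units_inv_right]
  simp only [← zpow_add, ← zpow_neg, neg_neg, smul_mul_assoc, Units.val_mul,
    Units.mul_inv_cancel_right, Units.mul_inv]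
  ring_nf

theorem qcommute_mul_inv_torusMonomial (haK : QCommute q (a : A) (K : A))
    (hx : HasTorusDegree q a K m n x) (hy : HasTorusDegree q a K i j y)
    (hxy : QCommute (q ^ s) x y) :
    QCommute (q ^ (s - (m * j - n * i))) (x * ↑(torusMonomial a K m n)⁻¹)
      (y * ↑(torusMonomial a K i j)⁻¹) := by
  have h := mul_inv_torusMonomial_mul haK hx hy (r := 0) (by rw [hxy, zero_smul, add_zero])
  rwa [zero_smul, smul_zero, add_zero] at h

end HasTorusDegree

end QCommute

section Torus

/-- The relations among `e = E a²`, `y = c K⁻¹ a⁻¹`, `z = b K⁻¹ a` and `f = F K a⁻²`: the pairs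
`(e, y)` and `(f, z)` satisfy quantum Weyl relations, and elements of different pairs commute up
to powers of `q`. -/
structure IsWeylPair {k A : Type*} [CommRing k] [Ring A] [Algebra k A] (q : kˣ) (e y z f : A) :
    Prop where
  ey : e * y = q ^ 2 • (y * e) + 1
  fz : f * z = q ^ (-2 : ℤ) • (z * f) + q • 1
  ez : QCommute (q ^ 2) e z
  ef : QCommute (q ^ (-2 : ℤ)) e f
  zy : QCommute (q ^ 2) z y
  yf : QCommute (q ^ 2) y f

/-- A quantum torus generated by the units `a` and `K`, together with elements that commute with it
and satisfy the relations `IsWeylPair`. -/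
structure IsTorusWeyl {k A : Type*} [CommRing k] [Ring A] [Algebra k A] (q : kˣ) (a K : Aˣ)
    (e y z f : A) : Prop extends IsWeylPair q e y z f where
  aK : QCommute q (a : A) (K : A)
  ae : Commute (a : A) e
  ay : Commute (a : A) y
  az : Commute (a : A) z
  af : Commute (a : A) f
  Ke : Commute (K : A) e
  Ky : Commute (K : A) y
  Kz : Commute (K : A) z
  Kf : Commute (K : A) f

variable {k : Type u} [Field k] {q : kˣ} {B : Type*} [Ring B] [Algebra k B]

theorem IsWeylPair.map {A : Type*} [Ring A] [Algebra k A] {e y z f : A}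
    (h : IsWeylPair q e y z f) (φ : A →ₐ[k] B) : IsWeylPair q (φ e) (φ y) (φ z) (φ f) where
  ey := by simpa [Units.smul_def] using congrArg φ h.ey
  fz := by simpa [Units.smul_def] using congrArg φ h.fz
  ez := h.ez.map φ
  ef := h.ef.map φ
  zy := h.zy.map φ
  yf := h.yf.map φ

theorem IsTorusWeyl.rotate {a K : Bˣ} {e y z f : B} (h : IsTorusWeyl q a K e y z f) :
    IsTorusWeyl q K a⁻¹ e y z f where
  toIsWeylPair := h.toIsWeylPair
  aK := h.aK.units_inv_left.symm.cast (inv_inv q)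
  ae := h.Ke
  ay := h.Ky
  az := h.Kz
  af := h.Kf
  Ke := h.ae.units_inv_left
  Ky := h.ay.units_inv_left
  Kz := h.az.units_inv_left
  Kf := h.af.units_inv_left

namespace Dq

variable (k q)

/-- The canonical projection of the free algebra onto `D_q`. -/
def mk : FreeAlgebra k Gen →ₐ[k] Dq k q := RingQuot.mkAlgHom k (Rel k q)

theorem mk_gen (x : Gen) : mk k q (gen k x) = of k q x := rfl

theorem adjoin_range_of : Algebra.adjoin k (Set.range (of k q)) = ⊤ := by
  have hrange : Set.range (of k q) = mk k q '' Set.range (FreeAlgebra.ι k) := by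
    rw [← Set.range_comp]; rfl
  rw [hrange, Algebra.adjoin_image, FreeAlgebra.adjoin_range_ι, Algebra.map_top,
    AlgHom.range_eq_top]
  exact RingQuot.mkAlgHom_surjective k (Rel k q)

variable {k q}

theorem mk_eq_of_rel {x y : FreeAlgebra k Gen} (h : Rel k q x y) : mk k q x = mk k q y :=
  RingQuot.mkAlgHom_rel k h

theorem commute_of_rel {x y : Gen} (h : Rel k q (gen k x * gen k y) (gen k y * gen k x)) :
    Commute (of k q x) (of k q y) := by
  have h' := mk_eq_of_rel h
  rwa [map_mul, map_mul] at h'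

theorem qcommute_of_rel {s : kˣ} {x y : Gen}
    (h : Rel k q (gen k x * gen k y) ((s : k) • (gen k y * gen k x))) :
    QCommute s (of k q x) (of k q y) := by
  have h' := mk_eq_of_rel h
  rwa [map_smul, map_mul, map_mul] at h'

variable (k q)

/-- `a` as a unit of `D_q`. -/
def aUnit : (Dq k q)ˣ where
  val := of k q .a
  inv := of k q .ainv
  val_inv := by
    simpa only [map_mul, map_one, mk_gen] using mk_eq_of_rel (Rel.a_ainv (k := k) (q := q))
  inv_val := by
    simpa only [map_mul, map_one, mk_gen] using mk_eq_of_rel (Rel.ainv_a (k := k) (q := q))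

/-- `K` as a unit of `D_q`. -/
def KUnit : (Dq k q)ˣ where
  val := of k q .K
  inv := of k q .Kinv
  val_inv := K_mul_Kinv k q
  inv_val := Kinv_mul_K k q

theorem qcommute_a_b : QCommute q (aUnit k q : Dq k q) (of k q .b) := qcommute_of_rel .ab

theorem qcommute_a_c : QCommute q (aUnit k q : Dq k q) (of k q .c) := qcommute_of_rel .ac

theorem commute_a_E : Commute (aUnit k q : Dq k q) (of k q .E) := (commute_of_rel .Ea).symm

theorem qcommute_F_a : QCommute q (of k q .F) (aUnit k q : Dq k q) := qcommute_of_rel .Fa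

theorem qcommute_K_a : QCommute q⁻¹ (KUnit k q : Dq k q) (aUnit k q : Dq k q) := K_mul_a k q

theorem qcommute_K_b : QCommute q (KUnit k q : Dq k q) (of k q .b) := qcommute_of_rel .Kb

theorem qcommute_K_c : QCommute q⁻¹ (KUnit k q : Dq k q) (of k q .c) := qcommute_of_rel .Kc

theorem qcommute_K_E : QCommute (q ^ 2) (KUnit k q : Dq k q) (of k q .E) := qcommute_of_rel .KE

theorem qcommute_K_F : QCommute (q ^ (-2 : ℤ)) (KUnit k q : Dq k q) (of k q .F) :=
  qcommute_of_rel .KF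

theorem commute_b_c : Commute (of k q .b) (of k q .c) := commute_of_rel .bc

theorem commute_E_F : Commute (of k q .E) (of k q .F) := commute_of_rel .EF

theorem commute_E_b : Commute (of k q .E) (of k q .b) := commute_of_rel .Eb

theorem qcommute_F_c : QCommute q (of k q .F) (of k q .c) := qcommute_of_rel .Fc

theorem E_mul_c : of k q .E * of k q .c
    = of k q .c * of k q .E + torusMonomial (aUnit k q) (KUnit k q) (-1) 1 := by
  have h := mk_eq_of_rel (Rel.Ec (k := k) (q := q))
  rw [map_add, map_mul, map_mul, map_mul] at h
  rw [torusMonomial, zpow_neg_one, zpow_one]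
  exact h

theorem F_mul_b : of k q .F * of k q .b = q⁻¹ • (of k q .b * of k q .F) + aUnit k q := by
  have h := mk_eq_of_rel (Rel.Fb (k := k) (q := q))
  rwa [map_add, map_smul, map_mul, map_mul] at h

theorem hasTorusDegree_E : HasTorusDegree q (aUnit k q) (KUnit k q) (-2) 0 (of k q .E) where
  left := (QCommute.of_commute (commute_a_E k q)).cast (by group)
  right := qcommute_K_E k q

theorem hasTorusDegree_c : HasTorusDegree q (aUnit k q) (KUnit k q) 1 1 (of k q .c) where
  left := (qcommute_a_c k q).cast (by group)
  right := (qcommute_K_c k q).cast (by group)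

theorem hasTorusDegree_b : HasTorusDegree q (aUnit k q) (KUnit k q) (-1) 1 (of k q .b) where
  left := (qcommute_a_b k q).cast (by group)
  right := (qcommute_K_b k q).cast (by group)

theorem hasTorusDegree_F : HasTorusDegree q (aUnit k q) (KUnit k q) 2 (-1) (of k q .F) where
  left := (qcommute_F_a k q).symm.cast (by group)
  right := qcommute_K_F k q

/-- The element `E a²` of `D_q`. -/
def e : Dq k q := of k q .E * ↑(torusMonomial (aUnit k q) (KUnit k q) (-2) 0)⁻¹

/-- The element `c K⁻¹ a⁻¹` of `D_q`. -/
def y : Dq k q := of k q .c * ↑(torusMonomial (aUnit k q) (KUnit k q) 1 1)⁻¹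

/-- The element `b K⁻¹ a` of `D_q`. -/
def z : Dq k q := of k q .b * ↑(torusMonomial (aUnit k q) (KUnit k q) (-1) 1)⁻¹

/-- The element `F K a⁻²` of `D_q`. -/
def f : Dq k q := of k q .F * ↑(torusMonomial (aUnit k q) (KUnit k q) 2 (-1))⁻¹

theorem qcommute_a_K : QCommute q (aUnit k q : Dq k q) (KUnit k q : Dq k q) :=
  (qcommute_K_a k q).symm.cast (inv_inv q)

theorem isWeylPair : IsWeylPair q (e k q) (y k q) (z k q) (f k q) where
  ey := by
    have hEc : of k q .E * of k q .c = q ^ (0 : ℤ) • (of k q .c * of k q .E)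
        + ((q ^ (-2 : ℤ) : kˣ) : k) • ↑(torusMonomial (aUnit k q) (KUnit k q) 1 1 *
          torusMonomial (aUnit k q) (KUnit k q) (-2) 0) := by
      rw [E_mul_c, torusMonomial_mul_torusMonomial (qcommute_a_K k q), ← Units.smul_def, smul_smul]
      simp
    refine ((hasTorusDegree_E k q).mul_inv_torusMonomial_mul (qcommute_a_K k q)
      (hasTorusDegree_c k q) hEc).trans ?_
    rw [← Units.smul_def, smul_smul, ← zpow_add]
    norm_num
    rfl
  fz := by
    have hFb : of k q .F * of k q .b = q ^ (-1 : ℤ) • (of k q .b * of k q .F)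
        + ((q ^ (2 : ℤ) : kˣ) : k) • ↑(torusMonomial (aUnit k q) (KUnit k q) (-1) 1 *
          torusMonomial (aUnit k q) (KUnit k q) 2 (-1)) := by
      rw [F_mul_b, torusMonomial_mul_torusMonomial (qcommute_a_K k q), ← Units.smul_def, smul_smul]
      simp [torusMonomial]
    refine ((hasTorusDegree_F k q).mul_inv_torusMonomial_mul (qcommute_a_K k q)
      (hasTorusDegree_b k q) hFb).trans ?_
    rw [← Units.smul_def, smul_smul, ← zpow_add]
    norm_num
    rfl
  ez := ((hasTorusDegree_E k q).qcommute_mul_inv_torusMonomial (qcommute_a_K k q)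
    (hasTorusDegree_b k q) (s := 0)
    ((QCommute.of_commute (commute_E_b k q)).cast (by group))).cast (by group)
  ef := ((hasTorusDegree_E k q).qcommute_mul_inv_torusMonomial (qcommute_a_K k q)
    (hasTorusDegree_F k q) (s := 0)
    ((QCommute.of_commute (commute_E_F k q)).cast (by group))).cast (by group)
  zy := ((hasTorusDegree_b k q).qcommute_mul_inv_torusMonomial (qcommute_a_K k q)
    (hasTorusDegree_c k q) (s := 0)
    ((QCommute.of_commute (commute_b_c k q)).cast (by group))).cast (by group)
  yf := ((hasTorusDegree_c k q).qcommute_mul_inv_torusMonomial (qcommute_a_K k q)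
    (hasTorusDegree_F k q) (s := -1)
    ((qcommute_F_c k q).symm.cast (by group))).cast (by group)

theorem isTorusWeyl : IsTorusWeyl q (aUnit k q) (KUnit k q) (e k q) (y k q) (z k q) (f k q) where
  toIsWeylPair := isWeylPair k q
  aK := qcommute_a_K k q
  ae := ((hasTorusDegree_E k q).mul_inv_torusMonomial (qcommute_a_K k q)).commute_left
  ay := ((hasTorusDegree_c k q).mul_inv_torusMonomial (qcommute_a_K k q)).commute_left
  az := ((hasTorusDegree_b k q).mul_inv_torusMonomial (qcommute_a_K k q)).commute_left
  af := ((hasTorusDegree_F k q).mul_inv_torusMonomial (qcommute_a_K k q)).commute_left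
  Ke := ((hasTorusDegree_E k q).mul_inv_torusMonomial (qcommute_a_K k q)).commute_right
  Ky := ((hasTorusDegree_c k q).mul_inv_torusMonomial (qcommute_a_K k q)).commute_right
  Kz := ((hasTorusDegree_b k q).mul_inv_torusMonomial (qcommute_a_K k q)).commute_right
  Kf := ((hasTorusDegree_F k q).mul_inv_torusMonomial (qcommute_a_K k q)).commute_right

theorem E_eq : of k q .E = e k q * torusMonomial (aUnit k q) (KUnit k q) (-2) 0 :=
  (Units.inv_mul_cancel_right _ _).symm

theorem c_eq : of k q .c = y k q * torusMonomial (aUnit k q) (KUnit k q) 1 1 :=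
  (Units.inv_mul_cancel_right _ _).symm

theorem b_eq : of k q .b = z k q * torusMonomial (aUnit k q) (KUnit k q) (-1) 1 :=
  (Units.inv_mul_cancel_right _ _).symm

theorem F_eq : of k q .F = f k q * torusMonomial (aUnit k q) (KUnit k q) 2 (-1) :=
  (Units.inv_mul_cancel_right _ _).symm

/-- The units `a` and `K`, their inverses, and the elements `e`, `y`, `z`, `f`. -/
def torusWeylGenerators : Set (Dq k q) :=
  {(aUnit k q : Dq k q), (↑(aUnit k q)⁻¹ : Dq k q), (KUnit k q : Dq k q),
    (↑(KUnit k q)⁻¹ : Dq k q), e k q, y k q, z k q, f k q}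

theorem adjoin_torusWeylGenerators : Algebra.adjoin k (torusWeylGenerators k q) = ⊤ := by
  set S := Algebra.adjoin k (torusWeylGenerators k q)
  have mem (x : Dq k q) (hx : x ∈ torusWeylGenerators k q) : x ∈ S := Algebra.subset_adjoin hx
  simp only [torusWeylGenerators, Set.mem_insert_iff, Set.mem_singleton_iff, forall_eq_or_imp,
    forall_eq] at mem
  obtain ⟨ha, ha', hK, hK', he, hy, hz, hf⟩ := mem
  have torus_mem (m n : ℤ) : (torusMonomial (aUnit k q) (KUnit k q) m n : Dq k q) ∈ S := by
    have haU : aUnit k q ∈ S.toSubmonoid.units := Submonoid.mem_units_iff _ _ |>.2 ⟨ha, ha'⟩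
    have hKU : KUnit k q ∈ S.toSubmonoid.units := Submonoid.mem_units_iff _ _ |>.2 ⟨hK, hK'⟩
    exact Submonoid.val_mem_of_mem_units _ (mul_mem (zpow_mem haU m) (zpow_mem hKU n))
  rw [eq_top_iff, ← adjoin_range_of, Algebra.adjoin_le_iff]
  rintro _ ⟨x, rfl⟩
  cases x
  case a => exact ha
  case ainv => exact ha'
  case K => exact hK
  case Kinv => exact hK'
  case b => rw [b_eq]; exact S.mul_mem hz (torus_mem _ _)
  case c => rw [c_eq]; exact S.mul_mem hy (torus_mem _ _)
  case E => rw [E_eq]; exact S.mul_mem he (torus_mem _ _)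
  case F => rw [F_eq]; exact S.mul_mem hf (torus_mem _ _)

/-- An algebra homomorphism out of `D_q` from images of the generators satisfying the
defining relations. -/
def lift (g : Gen → B)
    (hg : ∀ ⦃x y⦄, Rel k q x y → FreeAlgebra.lift k g x = FreeAlgebra.lift k g y) :
    Dq k q →ₐ[k] B :=
  RingQuot.liftAlgHom k ⟨FreeAlgebra.lift k g, hg⟩

theorem lift_of (g : Gen → B)
    (hg : ∀ ⦃x y⦄, Rel k q x y → FreeAlgebra.lift k g x = FreeAlgebra.lift k g y) (x : Gen) :
    lift k q g hg (of k q x) = g x :=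
  (RingQuot.liftAlgHom_mkAlgHom_apply k (FreeAlgebra.lift k g) hg (gen k x)).trans
    (FreeAlgebra.lift_ι_apply g x)

variable {k q}

theorem algHom_ext {φ ψ : Dq k q →ₐ[k] B}
    (ha : φ (aUnit k q : Dq k q) = ψ (aUnit k q : Dq k q))
    (hK : φ (KUnit k q : Dq k q) = ψ (KUnit k q : Dq k q)) (he : φ (e k q) = ψ (e k q))
    (hy : φ (y k q) = ψ (y k q)) (hz : φ (z k q) = ψ (z k q)) (hf : φ (f k q) = ψ (f k q)) :
    φ = ψ := by
  have map_inv_eq {v : (Dq k q)ˣ} (hv : φ (v : Dq k q) = ψ (v : Dq k q)) :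
      φ (↑v⁻¹ : Dq k q) = ψ (↑v⁻¹ : Dq k q) := by
    have hunits : Units.map (φ : Dq k q →* B) v = Units.map (ψ : Dq k q →* B) v := Units.ext hv
    exact congrArg (fun w : Bˣ => (↑w⁻¹ : B)) hunits
  refine AlgHom.ext_of_adjoin_eq_top (adjoin_torusWeylGenerators k q) ?_
  simp only [torusWeylGenerators, Set.EqOn, Set.mem_insert_iff, Set.mem_singleton_iff,
    forall_eq_or_imp, forall_eq]
  exact ⟨ha, map_inv_eq ha, hK, map_inv_eq hK, he, hy, hz, hf⟩

end Dq

/-- The images of the generators of `D_q` determined by images of `a`, `K`, `e`, `y`, `z`, `f`. -/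
def torusWeylImage (a K : Bˣ) (e y z f : B) : Gen → B
  | .a => a
  | .ainv => ↑a⁻¹
  | .K => K
  | .Kinv => ↑K⁻¹
  | .E => e * torusMonomial a K (-2) 0
  | .c => y * torusMonomial a K 1 1
  | .b => z * torusMonomial a K (-1) 1
  | .F => f * torusMonomial a K 2 (-1)

namespace IsTorusWeyl

variable {a K : Bˣ} {e y z f : B} (h : IsTorusWeyl q a K e y z f)
include h

theorem hasTorusDegree_e : HasTorusDegree q a K 0 0 e := .of_commute h.ae h.Ke

theorem hasTorusDegree_y : HasTorusDegree q a K 0 0 y := .of_commute h.ay h.Ky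

theorem hasTorusDegree_z : HasTorusDegree q a K 0 0 z := .of_commute h.az h.Kz

theorem hasTorusDegree_f : HasTorusDegree q a K 0 0 f := .of_commute h.af h.Kf

theorem lift_eq_of_rel ⦃s t : FreeAlgebra k Gen⦄ (hst : Rel k q s t) :
    FreeAlgebra.lift k (torusWeylImage a K e y z f) s =
      FreeAlgebra.lift k (torusWeylImage a K e y z f) t := by
  have he := h.hasTorusDegree_e
  have hy := h.hasTorusDegree_y
  have hz := h.hasTorusDegree_z
  have hf := h.hasTorusDegree_f
  cases hst <;>
    simp only [map_mul, map_smul, map_add, map_one, FreeAlgebra.lift_ι_apply, torusWeylImage]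
  case a_ainv => exact a.mul_inv
  case ainv_a => exact a.inv_mul
  case K_Kinv => exact K.mul_inv
  case Kinv_K => exact K.inv_mul
  case Ka => exact h.aK.symm
  case ab => exact (hz.mul_torusMonomial h.aK _ _).left.cast (zpow_one q)
  case ac => exact (hy.mul_torusMonomial h.aK _ _).left.cast (zpow_one q)
  case Ea => exact ((he.mul_torusMonomial h.aK _ _).left.commute (zpow_zero q)).symm
  case Fa => exact (hf.mul_torusMonomial h.aK _ _).left.symm.cast (by group)
  case KE => exact (he.mul_torusMonomial h.aK _ _).right
  case KF => exact (hf.mul_torusMonomial h.aK _ _).right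
  case Kb => exact (hz.mul_torusMonomial h.aK _ _).right.cast (by group)
  case Kc => exact (hy.mul_torusMonomial h.aK _ _).right.cast (by group)
  case bc =>
    exact (hz.qcommute_mul_torusMonomial h.aK hy (s := 2) h.zy _ _ _ _).commute (by group)
  case EF =>
    exact (he.qcommute_mul_torusMonomial h.aK hf (s := -2) h.ef _ _ _ _).commute (by group)
  case Eb =>
    exact (he.qcommute_mul_torusMonomial h.aK hz (s := 2) h.ez _ _ _ _).commute (by group)
  case Fc =>
    exact (hy.qcommute_mul_torusMonomial h.aK hf (s := 2) h.yf _ _ _ _).symm.cast (by group)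
  case Ec =>
    rw [he.mul_torusMonomial_mul h.aK hy (s := 2) (r := 1) (by rw [one_smul, h.ey]; rfl),
      torusMonomial_mul_torusMonomial h.aK]
    simp [torusMonomial]
  case Fb =>
    rw [hf.mul_torusMonomial_mul h.aK hz (s := -2) (r := (q : k)) (by rw [h.fz]; rfl),
      torusMonomial_mul_torusMonomial h.aK]
    simp [torusMonomial, Units.smul_def]

/-- The algebra homomorphism out of `D_q` given by the images of `a`, `K`, `e`, `y`, `z`, `f`. -/
def toAlgHom : Dq k q →ₐ[k] B := Dq.lift k q _ h.lift_eq_of_rel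

theorem toAlgHom_a : h.toAlgHom (Dq.aUnit k q : Dq k q) = a := Dq.lift_of ..

theorem toAlgHom_K : h.toAlgHom (Dq.KUnit k q : Dq k q) = K := Dq.lift_of ..

theorem toAlgHom_inv_a : h.toAlgHom (↑(Dq.aUnit k q)⁻¹ : Dq k q) = ↑a⁻¹ := Dq.lift_of ..

theorem toAlgHom_inv_K : h.toAlgHom (↑(Dq.KUnit k q)⁻¹ : Dq k q) = ↑K⁻¹ := Dq.lift_of ..

theorem toAlgHom_torusMonomial (m n : ℤ) :
    Units.map (h.toAlgHom : Dq k q →* B) (torusMonomial (Dq.aUnit k q) (Dq.KUnit k q) m n)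
      = torusMonomial a K m n := by
  simp only [torusMonomial, map_mul, map_zpow]
  congr 2
  · exact Units.ext h.toAlgHom_a
  · exact Units.ext h.toAlgHom_K

theorem toAlgHom_mul_inv_torusMonomial {X : Dq k q} {x : B} {m n : ℤ}
    (hX : h.toAlgHom X = x * torusMonomial a K m n) :
    h.toAlgHom (X * ↑(torusMonomial (Dq.aUnit k q) (Dq.KUnit k q) m n)⁻¹) = x := by
  have hinv := congrArg (fun v : Bˣ => (↑v⁻¹ : B)) (h.toAlgHom_torusMonomial m n)
  rw [map_mul, hX]
  exact (congrArg _ hinv).trans (Units.mul_inv_cancel_right _ _)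

theorem toAlgHom_e : h.toAlgHom (Dq.e k q) = e := h.toAlgHom_mul_inv_torusMonomial (Dq.lift_of ..)

theorem toAlgHom_y : h.toAlgHom (Dq.y k q) = y := h.toAlgHom_mul_inv_torusMonomial (Dq.lift_of ..)

theorem toAlgHom_z : h.toAlgHom (Dq.z k q) = z := h.toAlgHom_mul_inv_torusMonomial (Dq.lift_of ..)

theorem toAlgHom_f : h.toAlgHom (Dq.f k q) = f := h.toAlgHom_mul_inv_torusMonomial (Dq.lift_of ..)

end IsTorusWeyl

namespace Dq

open IsTorusWeyl

variable (k q)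

/-- The automorphism of `D_q` with `a ↦ K` and `K ↦ a⁻¹` that fixes `e`, `y`, `z` and `f`. -/
def rotation : Dq k q ≃ₐ[k] Dq k q :=
  have h := (isTorusWeyl k q).rotate
  have h' := h.rotate.rotate
  AlgEquiv.ofAlgHom h.toAlgHom h'.toAlgHom
    (by
      apply algHom_ext <;> simp only [AlgHom.comp_apply, AlgHom.id_apply, inv_inv, toAlgHom_a,
        toAlgHom_K, toAlgHom_inv_K, toAlgHom_e, toAlgHom_y, toAlgHom_z, toAlgHom_f])
    (by
      apply algHom_ext <;> simp only [AlgHom.comp_apply, AlgHom.id_apply, inv_inv, toAlgHom_a,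
        toAlgHom_K, toAlgHom_inv_a, toAlgHom_e, toAlgHom_y, toAlgHom_z, toAlgHom_f])

theorem rotation_a : rotation k q (of k q .a) = of k q .K :=
  (isTorusWeyl k q).rotate.toAlgHom_a

theorem nonempty_CA_equiv_CK : Nonempty (CA k q ≃ₐ[k] CK k q) := by
  have map_CA : (CA k q).map (rotation k q).toAlgHom = CK k q := by
    ext x
    obtain ⟨t, rfl⟩ := (rotation k q).surjective x
    simp only [Subalgebra.mem_map, AlgEquiv.coe_toAlgHom, EmbeddingLike.apply_eq_iff_eq,
      exists_eq_right, Subalgebra.mem_centralizer_iff, Set.mem_singleton_iff, forall_eq,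
      ← rotation_a, ← map_mul]
  exact ⟨((rotation k q).subalgebraMap (CA k q)).trans (Subalgebra.equivOfEq _ _ map_CA)⟩

end Dq

end Torus

section GenericFreeness

open Finsupp

/-- The span of the vectors `w γ` with `γ` below `α` in the monomial order. -/
def lowerSpan (R : Type*) {M σ : Type*} [CommRing R] [AddCommGroup M] [Module R M]
    (mo : MonomialOrder σ) (w : (σ →₀ ℕ) → M) (α : σ →₀ ℕ) : Submodule R M :=
  Submodule.span R (w '' {γ | mo.toSyn γ < mo.toSyn α})

/-- The ideal of all `r` for which `r • w α` lies in the span of the lower vectors. The module is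
generically free on the vectors `w α` with vanishing lead ideal. -/
def leadIdeal (R : Type*) {M σ : Type*} [CommRing R] [AddCommGroup M] [Module R M]
    (mo : MonomialOrder σ) (w : (σ →₀ ℕ) → M) (α : σ →₀ ℕ) : Ideal R :=
  (lowerSpan R mo w α).comap (LinearMap.toSpanSingleton R M (w α))

/-- The operators `x i` act on the vectors `w α` like variables on monomials, up to units and
lower terms. -/
def IsMonomialFamily {R M σ : Type*} [CommRing R] [AddCommGroup M] [Module R M]
    (mo : MonomialOrder σ) (x : σ → M →ₗ[R] M) (w : (σ →₀ ℕ) → M) : Prop :=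
  ∀ i α, ∃ u : Rˣ, x i (w α) - u • w (α + single i 1) ∈ lowerSpan R mo w (α + single i 1)

variable {R M σ : Type*} [CommRing R] [AddCommGroup M] [Module R M]
  {mo : MonomialOrder σ} {w : (σ →₀ ℕ) → M} {α γ : σ →₀ ℕ}

theorem mem_leadIdeal {r : R} : r ∈ leadIdeal R mo w α ↔ r • w α ∈ lowerSpan R mo w α := Iff.rfl

theorem mem_lowerSpan (h : mo.toSyn γ < mo.toSyn α) : w γ ∈ lowerSpan R mo w α :=
  Submodule.subset_span ⟨γ, h, rfl⟩

theorem lowerSpan_le {N : Submodule R M} (h : ∀ γ, mo.toSyn γ < mo.toSyn α → w γ ∈ N) :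
    lowerSpan R mo w α ≤ N :=
  Submodule.span_le.2 (Set.image_subset_iff.2 h)

theorem lowerSpan_zero : lowerSpan R mo w 0 = ⊥ :=
  le_bot_iff.1 (lowerSpan_le fun _ h => absurd (map_zero mo.toSyn ▸ h) (mo.zero_le _).not_gt)

namespace IsMonomialFamily

variable {x : σ → M →ₗ[R] M} (hx : IsMonomialFamily mo x w)
include hx

theorem map_lowerSpan_le (i : σ) (α : σ →₀ ℕ) :
    lowerSpan R mo w α ≤ (lowerSpan R mo w (α + single i 1)).comap (x i) :=
  lowerSpan_le fun γ hγ => by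
    obtain ⟨u, hu⟩ := hx i γ
    have hlt : mo.toSyn (γ + single i 1) < mo.toSyn (α + single i 1) := by
      rw [map_add, map_add]
      exact add_lt_add_left hγ _
    have hle : lowerSpan R mo w (γ + single i 1) ≤ lowerSpan R mo w (α + single i 1) :=
      lowerSpan_le fun δ hδ => mem_lowerSpan (hδ.trans hlt)
    exact (Submodule.sub_mem_iff_left _ (Submodule.smul_of_tower_mem _ u (mem_lowerSpan hlt))).1
      (hle hu)

theorem leadIdeal_le_add_single (i : σ) (α : σ →₀ ℕ) :
    leadIdeal R mo w α ≤ leadIdeal R mo w (α + single i 1) := by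
  intro r hr
  obtain ⟨u, hu⟩ := hx i α
  have hxr : r • x i (w α) ∈ lowerSpan R mo w (α + single i 1) := by
    rw [← map_smul]
    exact hx.map_lowerSpan_le i α hr
  have hur := sub_mem hxr (Submodule.smul_mem _ r hu)
  rw [smul_sub, sub_sub_cancel, smul_comm] at hur
  exact mem_leadIdeal.2 ((Submodule.smul_mem_iff' _ u).1 hur)

theorem leadIdeal_mono : Monotone (leadIdeal R mo w) := by
  intro α β h
  obtain ⟨δ, rfl⟩ := exists_add_of_le h
  clear h
  induction δ using Finsupp.induction_linear generalizing α with
  | zero => rw [add_zero]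
  | add f g hf hg => exact hf.trans (add_assoc α f g ▸ hg (α := α + f))
  | single i n =>
    induction n with
    | zero => rw [single_zero, add_zero]
    | succ n ih =>
      rw [single_add, ← add_assoc]
      exact ih.trans (hx.leadIdeal_le_add_single i _)

end IsMonomialFamily

/-- By Dickson's lemma, the product of nonzero elements of the ideals at the finitely many minimal
exponents lies in all of them. -/
theorem exists_ne_zero_forall_mem_of_monotone [IsDomain R] [Finite σ] {I : (σ →₀ ℕ) → Ideal R}
    (hI : Monotone I) : ∃ f : R, f ≠ 0 ∧ ∀ α, I α ≠ ⊥ → f ∈ I α := by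
  have minimal_finite : {α | Minimal (· ∈ {α | I α ≠ ⊥}) α}.Finite :=
    WellQuasiOrderedLE.finite_of_isAntichain (setOfPred_minimal_antichain _)
  have exists_mem (α) : ∃ r : R, r ≠ 0 ∧ (I α ≠ ⊥ → r ∈ I α) := by
    by_cases h : I α = ⊥
    · exact ⟨1, one_ne_zero, fun h' => absurd h h'⟩
    · obtain ⟨r, hr, hr0⟩ := Submodule.exists_mem_ne_zero_of_ne_bot h
      exact ⟨r, hr0, fun _ => hr⟩
  choose r hr0 hr using exists_mem
  refine ⟨∏ α ∈ minimal_finite.toFinset, r α, Finset.prod_ne_zero_iff.2 fun α _ => hr0 α,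
    fun α hα => ?_⟩
  obtain ⟨β, hβα, hβ⟩ := exists_minimal_le_of_wellFoundedLT (· ∈ {α | I α ≠ ⊥}) α hα
  exact hI hβα ((I β).mem_of_dvd
    (Finset.dvd_prod_of_mem r (minimal_finite.mem_toFinset.2 hβ)) (hr β hβ.prop))

theorem linearIndependent_of_leadIdeal_eq_bot :
    LinearIndependent R fun α : {α // leadIdeal R mo w α = ⊥} => w α := by
  classical
  rw [linearIndependent_iff]
  intro l hl
  by_contra hne
  obtain ⟨α, hα, hmax⟩ := l.support.exists_max_image (fun α => mo.toSyn α.1)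
    (Finsupp.support_nonempty_iff.2 hne)
  rw [Finsupp.linearCombination_apply, Finsupp.sum, ← Finset.add_sum_erase _ _ hα] at hl
  have lead_mem : l α ∈ leadIdeal R mo w α.1 := by
    rw [mem_leadIdeal, eq_neg_of_add_eq_zero_left hl]
    refine neg_mem (sum_mem fun γ hγ => Submodule.smul_mem _ _ (mem_lowerSpan ?_))
    rw [Finset.mem_erase] at hγ
    exact lt_of_le_of_ne (hmax γ hγ.2) fun h => hγ.1 (Subtype.ext (mo.toSyn.injective h))
  rw [α.2, Submodule.mem_bot] at lead_mem
  exact Finsupp.mem_support_iff.1 hα lead_mem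

theorem exists_pow_smul_mem_span_of_mem_leadIdeal {f : R}
    (hf : ∀ α, leadIdeal R mo w α ≠ ⊥ → f ∈ leadIdeal R mo w α)
    (hspan : Submodule.span R (Set.range w) = ⊤) (m : M) :
    ∃ n : ℕ, f ^ n • m ∈
      Submodule.span R (Set.range fun α : {α // leadIdeal R mo w α = ⊥} => w α) := by
  set N := Submodule.span R (Set.range fun α : {α // leadIdeal R mo w α = ⊥} => w α)
  let T := (Submodule.torsion' R (M ⧸ N) (Submonoid.powers f)).comap N.mkQ
  have mem_T {m : M} : m ∈ T ↔ ∃ n : ℕ, f ^ n • m ∈ N := by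
    simp only [T, Submodule.mem_comap, Submodule.mem_torsion'_iff, Subtype.exists,
      Submonoid.mem_powers_iff, exists_prop, Submonoid.mk_smul, exists_exists_eq_and,
      Submodule.mkQ_apply, ← Submodule.Quotient.mk_smul, Submodule.Quotient.mk_eq_zero]
  have w_mem (α) : w α ∈ T := by
    induction hs : mo.toSyn α using WellFoundedLT.induction generalizing α with
    | ind s ih =>
      subst hs
      by_cases h : leadIdeal R mo w α = ⊥
      · exact mem_T.2 ⟨0, by rw [pow_zero, one_smul]; exact Submodule.subset_span ⟨⟨α, h⟩, rfl⟩⟩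
      · have hlow : lowerSpan R mo w α ≤ T := lowerSpan_le fun γ hγ => ih _ hγ γ rfl
        obtain ⟨n, hn⟩ := mem_T.1 (hlow (hf α h))
        exact mem_T.2 ⟨n + 1, by rwa [pow_succ, mul_smul]⟩
  have T_eq_top : T = ⊤ :=
    top_le_iff.1 (hspan ▸ Submodule.span_le.2 (Set.range_subset_iff.2 w_mem))
  exact mem_T.1 (T_eq_top ▸ Submodule.mem_top)

/-- If `w 0` were torsion-free, then some localization at a single element `f ≠ 0` would be free
with `w 0` in a basis; but `w 0` is divisible by `g`, which does not become invertible. -/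
theorem IsMonomialFamily.exists_smul_eq_zero [IsDomain R] [Finite σ] {x : σ → M →ₗ[R] M}
    (hx : IsMonomialFamily mo x w) (hspan : Submodule.span R (Set.range w) = ⊤)
    (hdiv : ∀ g : R, g ≠ 0 → ∃ m : M, g • m = w 0)
    (hR : ∀ f : R, f ≠ 0 → ∃ g : R, g ≠ 0 ∧ ∀ n : ℕ, ¬ g ∣ f ^ n) :
    ∃ r : R, r ≠ 0 ∧ r • w 0 = 0 := by
  by_contra! torsionFree
  have leadIdeal_zero : leadIdeal R mo w 0 = ⊥ := by
    refine (Submodule.eq_bot_iff _).2 fun r hr => ?_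
    rw [mem_leadIdeal, lowerSpan_zero, Submodule.mem_bot] at hr
    by_contra hr0
    exact torsionFree r hr0 hr
  obtain ⟨f, hf0, hf⟩ := exists_ne_zero_forall_mem_of_monotone hx.leadIdeal_mono
  obtain ⟨g, hg0, hg⟩ := hR f hf0
  obtain ⟨m, hm⟩ := hdiv g hg0
  obtain ⟨n, hn⟩ := exists_pow_smul_mem_span_of_mem_leadIdeal hf hspan m
  obtain ⟨c, hc⟩ := Finsupp.mem_span_range_iff_exists_finsupp.1 hn
  have hfg : single ⟨0, leadIdeal_zero⟩ (f ^ n) = g • c :=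
    linearIndependent_of_leadIdeal_eq_bot (by
      rw [linearCombination_single, map_smul, linearCombination_apply, hc, smul_comm, hm])
  have hcoeff := DFunLike.congr_fun hfg ⟨0, leadIdeal_zero⟩
  rw [single_eq_same, Finsupp.smul_apply, smul_eq_mul] at hcoeff
  exact hg n ⟨_, hcoeff⟩

end GenericFreeness

section Reorderable

theorem smul_mem_of_adjoin_eq_top {R A M : Type*} [CommSemiring R] [Semiring A] [Algebra R A]
    [AddCommMonoid M] [Module R M] [Module A M] [IsScalarTower R A M] {s : Set A}
    (hs : Algebra.adjoin R s = ⊤) {N : Submodule R M} (hN : ∀ x ∈ s, ∀ m ∈ N, x • m ∈ N)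
    (t : A) {m : M} (hm : m ∈ N) : t • m ∈ N := by
  have ht : t ∈ Algebra.adjoin R s := hs ▸ Algebra.mem_top
  induction ht using Algebra.adjoin_induction generalizing m with
  | mem x hx => exact hN x hx m hm
  | algebraMap r => rw [algebraMap_smul]; exact N.smul_mem r hm
  | add x y _ _ hx hy => rw [add_smul]; exact add_mem (hx hm) (hy hm)
  | mul x y _ _ hx hy => rw [mul_smul]; exact hx (hy hm)

theorem mul_pow_of_mul_eq_smul_add {R A : Type*} [CommRing R] [Ring A] [Algebra R A] {x p : A}
    {s t : R} (h : x * p = s • (p * x) + t • 1) (n : ℕ) :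
    x * p ^ n = s ^ n • (p ^ n * x) + (t * ∑ i ∈ Finset.range n, s ^ i) • p ^ (n - 1) := by
  induction n with
  | zero => simp
  | succ n ih =>
    have hp : (t * ∑ i ∈ Finset.range n, s ^ i) • p ^ (n - 1) * p
        = (t * ∑ i ∈ Finset.range n, s ^ i) • p ^ n := by
      cases n with
      | zero => simp
      | succ n => rw [smul_mul_assoc, Nat.add_sub_cancel, ← pow_succ]
    rw [pow_succ p, ← mul_assoc, ih, add_mul, hp, smul_mul_assoc, mul_assoc, h, mul_add,
      mul_smul_comm, mul_smul_comm, mul_one, smul_add, smul_smul, smul_smul, ← mul_assoc,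
      ← pow_succ, ← pow_succ, add_assoc, ← add_smul, Nat.add_sub_cancel,
      Finset.sum_range_succ, mul_add, add_comm (t * ∑ i ∈ _, _), mul_comm t (s ^ n)]

/-- The elements `x 0, …, x (n - 1)` can be reordered up to units and scalars. -/
def IsReorderable (R : Type*) {A : Type*} [CommRing R] [Ring A] [Algebra R A] {n : ℕ}
    (x : Fin n → A) : Prop :=
  ∀ i j, i < j → ∃ (s : Rˣ) (t : R), x j * x i = s • (x i * x j) + t • 1

/-- The monomial `x 0 ^ α 0 * ⋯ * x (n - 1) ^ α (n - 1)`. -/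
def orderedMonomial {A : Type*} [Monoid A] {n : ℕ} (x : Fin n → A) (α : Fin n → ℕ) : A :=
  (List.ofFn fun i => x i ^ α i).prod

theorem orderedMonomial_zero {A : Type*} [Monoid A] {n : ℕ} (x : Fin n → A) :
    orderedMonomial x 0 = 1 := by
  simp [orderedMonomial]

theorem orderedMonomial_cons {A : Type*} [Monoid A] {n : ℕ} (x : Fin (n + 1) → A) (a : ℕ)
    (β : Fin n → ℕ) :
    orderedMonomial x (Fin.cons a β) = x 0 ^ a * orderedMonomial (Fin.tail x) β := by
  simp [orderedMonomial, Fin.tail]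

namespace IsReorderable

variable {R A : Type*} [CommRing R] [Ring A] [Algebra R A] {n : ℕ}

theorem tail {x : Fin (n + 1) → A} (h : IsReorderable R x) : IsReorderable R (Fin.tail x) :=
  fun i j hij => h i.succ j.succ (Fin.succ_lt_succ_iff.2 hij)

theorem of_isScalarTower (R' : Type*) [CommRing R'] [Algebra R R'] [Algebra R' A]
    [IsScalarTower R R' A] {x : Fin n → A} (h : IsReorderable R x) : IsReorderable R' x := by
  intro i j hij
  obtain ⟨s, t, hst⟩ := h i j hij
  refine ⟨Units.map (algebraMap R R') s, algebraMap R R' t, ?_⟩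
  simpa [Units.smul_def, algebraMap_smul] using hst

theorem exists_mul_orderedMonomial_sub_mem_span {x : Fin n → A} (h : IsReorderable R x) (j : Fin n)
    (α : Fin n → ℕ) : ∃ s : Rˣ, x j * orderedMonomial x α
      - s • orderedMonomial x (α + Pi.single j 1) ∈
        Submodule.span R (orderedMonomial x '' Set.Iic α) := by
  induction n with
  | zero => exact j.elim0
  | succ n ih =>
    obtain ⟨a, β, rfl⟩ : ∃ a β, α = Fin.cons a β := ⟨_, _, (Fin.cons_self_tail α).symm⟩
    have cons_mem_span {b : ℕ} (hb : b ≤ a) {γ : Fin n → ℕ} (hγ : γ ≤ β) :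
        x 0 ^ b * orderedMonomial (Fin.tail x) γ ∈
          Submodule.span R (orderedMonomial x '' Set.Iic (Fin.cons a β)) :=
      Submodule.subset_span ⟨Fin.cons b γ, Fin.cons_le_cons.2 ⟨hb, hγ⟩, orderedMonomial_cons x b γ⟩
    cases j using Fin.cases with
    | zero =>
      have add_single : Fin.cons a β + Pi.single 0 1 = (Fin.cons (a + 1) β : Fin (n + 1) → ℕ) := by
        funext i; cases i using Fin.cases <;> simp
      refine ⟨1, ?_⟩
      rw [add_single, orderedMonomial_cons, orderedMonomial_cons, one_smul, pow_succ', mul_assoc,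
        sub_self]
      exact zero_mem _
    | succ j =>
      have add_single : Fin.cons a β + Pi.single j.succ 1
          = (Fin.cons a (β + Pi.single j 1) : Fin (n + 1) → ℕ) := by
        funext i; cases i using Fin.cases <;> simp [Pi.single_apply]
      obtain ⟨s, t, hst⟩ := h 0 j.succ j.succ_pos
      obtain ⟨r, hr⟩ := ih h.tail j β
      have mul_mem_span : Submodule.span R (orderedMonomial (Fin.tail x) '' Set.Iic β) ≤
          (Submodule.span R (orderedMonomial x '' Set.Iic (Fin.cons a β))).comap
            (LinearMap.mulLeft R (x 0 ^ a)) :=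
        Submodule.span_le.2 (Set.image_subset_iff.2 fun γ hγ => cons_mem_span le_rfl hγ)
      refine ⟨s ^ a * r, ?_⟩
      rw [Units.smul_def] at hst
      rw [add_single, orderedMonomial_cons, orderedMonomial_cons, ← mul_assoc,
        mul_pow_of_mul_eq_smul_add hst, add_mul, smul_mul_assoc, smul_mul_assoc, mul_assoc,
        add_sub_right_comm, mul_smul, ← mul_smul_comm r, ← Units.val_pow_eq_pow_val,
        ← Units.smul_def, ← smul_sub, ← mul_sub]
      exact add_mem (Submodule.smul_of_tower_mem _ _ (mul_mem_span hr))
        (Submodule.smul_mem _ _ (cons_mem_span (Nat.sub_le a 1) le_rfl))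

theorem span_range_orderedMonomial {x : Fin n → A} (h : IsReorderable R x)
    (hgen : Algebra.adjoin R (Set.range x) = ⊤) :
    Submodule.span R (Set.range (orderedMonomial x)) = ⊤ := by
  set N := Submodule.span R (Set.range (orderedMonomial x))
  have monomial_mem (α : Fin n → ℕ) : orderedMonomial x α ∈ N := Submodule.subset_span ⟨α, rfl⟩
  have mul_mem (j : Fin n) : N ≤ N.comap (LinearMap.mulLeft R (x j)) := by
    refine Submodule.span_le.2 (Set.range_subset_iff.2 fun α => ?_)
    obtain ⟨s, hs⟩ := h.exists_mul_orderedMonomial_sub_mem_span j α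
    exact (Submodule.sub_mem_iff_left N (N.smul_of_tower_mem s (monomial_mem _))).1
      (Submodule.span_mono (Set.image_subset_range _ _) hs)
  have one_mem : (1 : A) ∈ N := orderedMonomial_zero x ▸ monomial_mem 0
  refine Submodule.eq_top_iff'.2 fun t => ?_
  rw [← mul_one t]
  exact smul_mem_of_adjoin_eq_top hgen (Set.forall_mem_range.2 fun j m hm => mul_mem j hm) t one_mem

open Finsupp in
theorem isMonomialFamily {x : Fin n → A} (h : IsReorderable R x) (mo : MonomialOrder (Fin n))
    {M : Type*} [AddCommGroup M] [Module R M] [Module A M] [IsScalarTower R A M] (v : M) :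
    IsMonomialFamily mo (fun i => Algebra.lsmul R R M (x i))
      (fun α => orderedMonomial x α • v) := by
  intro i α
  obtain ⟨s, hs⟩ := h.exists_mul_orderedMonomial_sub_mem_span i α
  have smul_mem_lowerSpan : Submodule.span R (orderedMonomial x '' Set.Iic α) ≤
      (lowerSpan R mo (fun β => orderedMonomial x β • v) (α + single i 1)).comap
        ((LinearMap.toSpanSingleton A M v).restrictScalars R) := by
    refine Submodule.span_le.2 (Set.image_subset_iff.2 fun γ hγ => ?_)
    have hlt : equivFunOnFinite.symm γ < α + single i 1 :=
      lt_of_le_of_lt (b := α) hγ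
        (lt_add_of_pos_right α (pos_iff_ne_zero.2 (single_ne_zero.2 one_ne_zero)))
    exact mem_lowerSpan (mo.toSyn_strictMono hlt)
  refine ⟨s, ?_⟩
  have hlow := smul_mem_lowerSpan hs
  simpa [sub_smul, mul_smul, Units.smul_def, single_eq_pi_single] using hlow

theorem exists_smul_eq_zero [IsDomain R]
    (hR : ∀ f : R, f ≠ 0 → ∃ g : R, g ≠ 0 ∧ ∀ n : ℕ, ¬ g ∣ f ^ n)
    {x : Fin n → A} (h : IsReorderable R x) (hgen : Algebra.adjoin R (Set.range x) = ⊤)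
    {M : Type*} [AddCommGroup M] [Module R M] [Module A M] [IsScalarTower R A M]
    [IsSimpleModule A M] (v : M) : ∃ r : R, r ≠ 0 ∧ r • v = 0 := by
  by_contra! torsionFree
  have span_eq_top : Submodule.span R (Set.range fun α => orderedMonomial x α • v) = ⊤ := by
    have range_eq : Set.range (fun α => orderedMonomial x α • v)
        = (LinearMap.toSpanSingleton A M v).restrictScalars R '' Set.range (orderedMonomial x) := by
      rw [← Set.range_comp]; rfl
    rw [range_eq, Submodule.span_image, h.span_range_orderedMonomial hgen, Submodule.map_top,
      LinearMap.range_eq_top]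
    exact IsSimpleModule.toSpanSingleton_surjective A (by simpa using torsionFree 1 one_ne_zero)
  have divisible (g : R) (hg : g ≠ 0) : ∃ m : M, g • m = v :=
    LinearMap.surjective_of_ne_zero (f := algebraMap R (Module.End A M) g)
      (fun h0 => torsionFree g hg (DFunLike.congr_fun h0 v)) v
  have smul_zero_monomial : orderedMonomial x (0 : Fin n →₀ ℕ) • v = v := by
    rw [Finsupp.coe_zero, orderedMonomial_zero, one_smul]
  obtain ⟨r, hr, hrv⟩ := (h.isMonomialFamily MonomialOrder.lex v).exists_smul_eq_zero
    (by rw [← span_eq_top, ← Finsupp.equivFunOnFinite.surjective.range_comp]; rfl)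
    (by rwa [smul_zero_monomial]) hR
  exact torsionFree r hr (smul_zero_monomial ▸ hrv)

end IsReorderable

open Polynomial in
theorem exists_polynomial_not_dvd_pow {k : Type*} [Field k] {f : k[X]} (hf : f ≠ 0) :
    ∃ g : k[X], g ≠ 0 ∧ ∀ n : ℕ, ¬ g ∣ f ^ n := by
  have degree_pos : 0 < (X * f + Polynomial.C 1).natDegree := by
    rw [natDegree_add_C, natDegree_X_mul hf]
    exact Nat.succ_pos _
  have coprime : IsCoprime (X * f + Polynomial.C 1) f := ⟨1, -X, by rw [Polynomial.C_1]; ring⟩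
  refine ⟨X * f + Polynomial.C 1, ne_zero_of_natDegree_gt degree_pos, fun n hn => ?_⟩
  exact degree_pos.ne' (natDegree_eq_zero_of_isUnit (coprime.pow_right.isUnit_of_dvd hn))

theorem exists_algebraMap_eq_of_isAlgebraic {k A : Type*} [Field k] [IsAlgClosed k] [Ring A]
    [IsDomain A] [Algebra k A] {x : A} (hx : IsAlgebraic k x) : ∃ c : k, algebraMap k A c = x :=
  minpoly.mem_range_of_degree_eq_one k x
    (IsAlgClosed.degree_eq_one_of_irreducible k (minpoly.irreducible hx.isIntegral))

open Polynomial in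
/-- Quillen's lemma: with `X` acting as `z`, the algebra `A` is generically free over `k[X]`, so the
simple module `M` has torsion, which makes `z` algebraic in the division ring of endomorphisms. -/
theorem IsReorderable.exists_smul_eq_of_mem_center {k A : Type*} [Field k] [IsAlgClosed k] [Ring A]
    [Algebra k A] {n : ℕ} {x : Fin n → A} (h : IsReorderable k x) {z : A}
    (hz : z ∈ Subalgebra.center k A) (hgen : Algebra.adjoin k (insert z (Set.range x)) = ⊤)
    (M : Type*) [AddCommGroup M] [Module k M] [Module A M] [IsScalarTower k A M]
    [IsSimpleModule A M] : ∃ c : k, ∀ m : M, z • m = c • m := by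
  have aeval_mem_center (p : k[X]) : aeval z p ∈ Subalgebra.center k A :=
    Algebra.adjoin_le (Set.singleton_subset_iff.2 hz) (aeval_mem_adjoin_singleton k z)
  have commutes (p : k[X]) (t : A) : aeval z p * t = t * aeval z p :=
    (Subalgebra.mem_center_iff.1 (aeval_mem_center p) t).symm
  let : Algebra k[X] A := (aeval z : k[X] →ₐ[k] A).toRingHom.toAlgebra' commutes
  have : IsScalarTower k k[X] A := .of_algebraMap_eq fun c => (aeval_C z c).symm
  let : Module k[X] M := Module.compHom M (aeval z : k[X] →ₐ[k] A).toRingHom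
  have : IsScalarTower k[X] A M := ⟨fun p t m => mul_smul (aeval z p) t m⟩
  have : IsScalarTower k k[X] M := .of_algebraMap_smul fun c m => by
    rw [← algebraMap_smul A (algebraMap k k[X] c), ← IsScalarTower.algebraMap_apply,
      algebraMap_smul]
  have generates : Algebra.adjoin k[X] (Set.range x) = ⊤ := by
    refine top_le_iff.1 fun t _ => ?_
    have adjoin_le : Algebra.adjoin k (insert z (Set.range x)) ≤
        (Algebra.adjoin k[X] (Set.range x)).restrictScalars k :=
      Algebra.adjoin_le (Set.insert_subset
        (aeval_X (R := k) z ▸ Subalgebra.algebraMap_mem _ (X : k[X])) Algebra.subset_adjoin)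
    exact adjoin_le (hgen ▸ Algebra.mem_top)
  have : Nontrivial M := IsSimpleModule.nontrivial A M
  obtain ⟨v, hv⟩ := exists_ne (0 : M)
  obtain ⟨r, hr, hrv⟩ := (h.of_isScalarTower k[X]).exists_smul_eq_zero
    (fun _ => exists_polynomial_not_dvd_pow) generates v
  let φ : Module.End A M := algebraMap k[X] (Module.End A M) X
  have aeval_apply (p : k[X]) (m : M) : aeval φ p m = p • m := by
    rw [aeval_algebraMap_apply, aeval_X_left_apply]; rfl
  have aeval_eq_zero : aeval φ r = 0 := by
    by_contra hne
    exact hv (LinearMap.injective_of_ne_zero hne (by rw [aeval_apply, hrv, map_zero]))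
  have : IsDomain (Module.End A M) := by classical infer_instance
  obtain ⟨c, hc⟩ := exists_algebraMap_eq_of_isAlgebraic (k := k) (x := φ) ⟨r, hr, aeval_eq_zero⟩
  refine ⟨c, fun m => ?_⟩
  calc z • m = aeval z (X : k[X]) • m := by rw [aeval_X]
    _ = algebraMap k (Module.End A M) c m := by rw [hc]; rfl
    _ = c • m := rfl

end Reorderable

section Grading

theorem exists_mul_eq_mul_of_mem_adjoin {R A : Type*} [CommRing R] [Ring A] [Algebra R A]
    {s : Set A} {u t : A} (h : ∀ x ∈ s, ∃ r : R, u * x = r • (x * u))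
    (ht : t ∈ Algebra.adjoin R s) : ∃ t' ∈ Algebra.adjoin R s, u * t = t' * u := by
  induction ht using Algebra.adjoin_induction with
  | mem x hx =>
    obtain ⟨r, hr⟩ := h x hx
    exact ⟨r • x, Subalgebra.smul_mem _ (Algebra.subset_adjoin hx) r, by rw [hr, smul_mul_assoc]⟩
  | algebraMap r =>
    exact ⟨algebraMap R A r, Subalgebra.algebraMap_mem _ r, (Algebra.commutes r u).symm⟩
  | add x y _ _ hx hy =>
    obtain ⟨x', hx', hxu⟩ := hx
    obtain ⟨y', hy', hyu⟩ := hy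
    exact ⟨x' + y', add_mem hx' hy', by rw [mul_add, hxu, hyu, add_mul]⟩
  | mul x y _ _ hx hy =>
    obtain ⟨x', hx', hxu⟩ := hx
    obtain ⟨y', hy', hyu⟩ := hy
    exact ⟨x' * y', mul_mem hx' hy', by rw [← mul_assoc, hxu, mul_assoc, hyu, mul_assoc]⟩

variable (k : Type u) [Field k] (q : kˣ)

namespace Dq

/-- The component of degree `i` of the grading of `D_q` by conjugation by `a`: all `x` with
`a x a⁻¹ = qⁱ x`. -/
def gr (i : ℤ) : Submodule k (Dq k q) :=
  Module.End.eigenspace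
    (LinearMap.mulLeft k (aUnit k q : Dq k q) ∘ₗ LinearMap.mulRight k (↑(aUnit k q)⁻¹ : Dq k q))
    ((q ^ i : kˣ) : k)

variable {k q}

theorem mem_gr {i : ℤ} {x : Dq k q} :
    x ∈ gr k q i ↔ QCommute (q ^ i) (aUnit k q : Dq k q) x := by
  rw [gr, Module.End.mem_eigenspace_iff, LinearMap.comp_apply, LinearMap.mulRight_apply,
    LinearMap.mulLeft_apply, ← mul_assoc, Units.mul_inv_eq_iff_eq_mul, smul_mul_assoc]
  rfl

theorem mem_CA {x : Dq k q} : x ∈ CA k q ↔ Commute (aUnit k q : Dq k q) x := by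
  rw [Subalgebra.mem_centralizer_iff]
  exact forall_eq

theorem mem_gr_zero {x : Dq k q} : x ∈ gr k q 0 ↔ x ∈ CA k q := by
  rw [mem_gr, mem_CA, zpow_zero]
  exact ⟨fun h => h.commute rfl, QCommute.of_commute⟩

theorem mul_mem_gr {i j : ℤ} {x y : Dq k q} (hx : x ∈ gr k q i) (hy : y ∈ gr k q j) :
    x * y ∈ gr k q (i + j) :=
  mem_gr.2 (((mem_gr.1 hx).mul_right (mem_gr.1 hy)).cast (zpow_add q i j).symm)

variable (k q)

theorem KUnit_zpow_mem_gr (j : ℤ) : (↑(KUnit k q ^ j) : Dq k q) ∈ gr k q j :=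
  mem_gr.2 (((qcommute_K_a k q).units_zpow_left j).symm.cast (by rw [inv_zpow, inv_inv]))

/-- The subalgebra generated by `a`, `a⁻¹`, `e`, `y`, `z`, `f`. -/
def torusCentralizer : Subalgebra k (Dq k q) :=
  Algebra.adjoin k
    {(aUnit k q : Dq k q), (↑(aUnit k q)⁻¹ : Dq k q), e k q, y k q, z k q, f k q}

theorem torusCentralizer_le_CA : torusCentralizer k q ≤ CA k q := by
  have h := isTorusWeyl k q
  refine Algebra.adjoin_le ?_
  rintro x (rfl | rfl | rfl | rfl | rfl | rfl) <;> refine mem_CA.2 ?_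
  exacts [.refl _, (Commute.refl _).units_inv_right, h.ae, h.ay, h.az, h.af]

variable {k q}

theorem exists_KUnit_zpow_mul_eq (j : ℤ) {t : Dq k q} (ht : t ∈ torusCentralizer k q) :
    ∃ t' ∈ torusCentralizer k q, (↑(KUnit k q ^ j) : Dq k q) * t = t' * ↑(KUnit k q ^ j) := by
  have h := isTorusWeyl k q
  refine exists_mul_eq_mul_of_mem_adjoin (fun x hx => ?_) ht
  suffices qcommute : ∃ s : kˣ, QCommute s (KUnit k q : Dq k q) x by
    obtain ⟨s, hs⟩ := qcommute
    exact ⟨(s ^ j : kˣ), hs.units_zpow_left j⟩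
  rcases hx with rfl | rfl | rfl | rfl | rfl | rfl
  exacts [⟨_, qcommute_K_a k q⟩, ⟨_, (qcommute_K_a k q).units_inv_right⟩, ⟨1, .of_commute h.Ke⟩,
    ⟨1, .of_commute h.Ky⟩, ⟨1, .of_commute h.Kz⟩, ⟨1, .of_commute h.Kf⟩]

variable (k q)

/-- The space of all `t Kʲ` with `t` in `torusCentralizer k q`. -/
def torusGr (j : ℤ) : Submodule k (Dq k q) :=
  (Subalgebra.toSubmodule (torusCentralizer k q)).map
    (LinearMap.mulRight k (↑(KUnit k q ^ j) : Dq k q))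

theorem torusGr_le_gr (j : ℤ) : torusGr k q j ≤ gr k q j := by
  rintro _ ⟨t, ht, rfl⟩
  have ht0 := mem_gr_zero.2 (torusCentralizer_le_CA k q ht)
  simpa only [zero_add, LinearMap.mulRight_apply] using mul_mem_gr ht0 (KUnit_zpow_mem_gr k q j)

theorem torusGr_zero : torusGr k q 0 = Subalgebra.toSubmodule (torusCentralizer k q) := by
  rw [torusGr, zpow_zero, Units.val_one, LinearMap.mulRight_one, Submodule.map_id]

variable {k q}

theorem mul_mem_torusGr {i j : ℤ} {x y : Dq k q} (hx : x ∈ torusGr k q i)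
    (hy : y ∈ torusGr k q j) : x * y ∈ torusGr k q (i + j) := by
  obtain ⟨s, hs, rfl⟩ := hx
  obtain ⟨t, ht, rfl⟩ := hy
  obtain ⟨t', ht', h⟩ := exists_KUnit_zpow_mul_eq i ht
  refine ⟨s * t', Subalgebra.mul_mem _ hs ht', ?_⟩
  calc s * t' * ↑(KUnit k q ^ (i + j))
      = s * (t' * ↑(KUnit k q ^ i)) * ↑(KUnit k q ^ j) := by
        rw [zpow_add, Units.val_mul]; simp only [mul_assoc]
    _ = s * ↑(KUnit k q ^ i) * (t * ↑(KUnit k q ^ j)) := by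
        rw [← h]; simp only [mul_assoc]

variable (k q)

theorem iSup_torusGr : ⨆ j, torusGr k q j = ⊤ := by
  have zpow_mem (j : ℤ) : (↑(KUnit k q ^ j) : Dq k q) ∈ torusGr k q j :=
    ⟨1, Subalgebra.one_mem _, one_mul _⟩
  have of_mem_adjoin (x) (hx : x ∈ torusCentralizer k q) : ∃ i, x ∈ torusGr k q i :=
    ⟨0, torusGr_zero k q ▸ hx⟩
  have generator_mem (x) (hx : x ∈ torusWeylGenerators k q) : ∃ i, x ∈ torusGr k q i := by
    rcases hx with rfl | rfl | rfl | rfl | rfl | rfl | rfl | rfl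
    case inr.inr.inl => exact ⟨1, zpow_one (KUnit k q) ▸ zpow_mem 1⟩
    case inr.inr.inr.inl => exact ⟨-1, zpow_neg_one (KUnit k q) ▸ zpow_mem (-1)⟩
    all_goals exact of_mem_adjoin _ (Algebra.subset_adjoin (by simp))
  refine Submodule.eq_top_iff'.2 fun t => mul_one t ▸ smul_mem_of_adjoin_eq_top
    (adjoin_torusWeylGenerators k q) (fun x hx m hm => ?_) t
    (Submodule.mem_iSup_of_mem 0 (torusGr_zero k q ▸ Subalgebra.one_mem _))
  obtain ⟨i, hi⟩ := generator_mem x hx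
  have le_comap : ⨆ j, torusGr k q j ≤ (⨆ j, torusGr k q j).comap (LinearMap.mulLeft k x) :=
    iSup_le fun j y hy => Submodule.mem_iSup_of_mem (i + j) (mul_mem_torusGr hi hy)
  exact le_comap hm

theorem iSup_gr : ⨆ j, gr k q j = ⊤ :=
  top_le_iff.1 (iSup_torusGr k q ▸ iSup_mono (torusGr_le_gr k q))

variable {k q}

theorem iSupIndep_gr (hq : ¬ IsOfFinOrder q) : iSupIndep (gr k q) :=
  (Module.End.eigenspaces_iSupIndep _).comp
    (Units.val_injective.comp (injective_zpow_iff_not_isOfFinOrder.2 hq))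

theorem CA_eq_torusCentralizer (hq : ¬ IsOfFinOrder q) : CA k q = torusCentralizer k q := by
  have gr_eq : torusGr k q = gr k q :=
    ((iSupIndep_gr hq).le_iff_eq_of_iSup_eq_top (iSup_torusGr k q)).1 (torusGr_le_gr k q)
  ext x
  rw [← mem_gr_zero, ← gr_eq, torusGr_zero, Subalgebra.mem_toSubmodule]

theorem isCompl_gr_zero (hq : ¬ IsOfFinOrder q) :
    IsCompl (gr k q 0) (⨆ (j) (_ : j ≠ 0), gr k q j) :=
  ⟨iSupIndep_gr hq 0, codisjoint_iff.2 ((iSup_split_single _ 0).symm.trans (iSup_gr k q))⟩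

/-- The projection onto the component of degree zero is right `C(a, D_q)`-linear. -/
theorem exists_retraction_CA (hq : ¬ IsOfFinOrder q) :
    ∃ p : Dq k q →+ CA k q, p 1 = 1 ∧ ∀ (d : Dq k q) (t : CA k q), p (d * t) = p d * t := by
  let p : Dq k q →+ CA k q :=
    (LinearEquiv.ofEq (gr k q 0) (Subalgebra.toSubmodule (CA k q))
      (Submodule.ext fun _ => mem_gr_zero)).toLinearMap.toAddMonoidHom.comp
      ((gr k q 0).projectionOnto _ (isCompl_gr_zero hq)).toAddMonoidHom
  have p_coe (t : CA k q) : p t = t :=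
    Subtype.ext (congrArg (Subtype.val (p := (· ∈ gr k q 0)))
      ((gr k q 0).projectionOnto_apply_left (isCompl_gr_zero hq) ⟨t, mem_gr_zero.2 t.2⟩))
  have p_eq_zero {j : ℤ} (hj : j ≠ 0) {x : Dq k q} (hx : x ∈ gr k q j) : p x = 0 :=
    Subtype.ext (congrArg (Subtype.val (p := (· ∈ gr k q 0)))
      ((gr k q 0).projectionOnto_apply_right (isCompl_gr_zero hq)
        ⟨x, Submodule.mem_iSup_of_mem j (Submodule.mem_iSup_of_mem hj hx)⟩))
  refine ⟨p, p_coe 1, fun d t => ?_⟩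
  have hd : d ∈ ⨆ j, gr k q j := iSup_gr k q ▸ Submodule.mem_top
  induction hd using Submodule.iSup_induction' with
  | mem j d hd =>
    have hdt : d * t ∈ gr k q j := by
      simpa only [add_zero] using mul_mem_gr hd (mem_gr_zero.2 t.2)
    by_cases hj : j = 0
    · subst hj
      lift d to CA k q using mem_gr_zero.1 hd
      rw [p_coe]
      exact p_coe (d * t)
    · rw [p_eq_zero hj hdt, p_eq_zero hj hd, zero_mul]
  | zero => rw [zero_mul, map_zero, zero_mul]
  | add x y _ _ hx hy => rw [add_mul, map_add, hx, hy, map_add, add_mul]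

end Dq

end Grading

section CentralCharacter

namespace CA

open Dq

variable (k : Type u) [Field k] (q : kˣ)

/-- `a` as a unit of its centralizer. -/
def a : (CA k q)ˣ where
  val := ⟨aUnit k q, mem_CA.2 (.refl _)⟩
  inv := ⟨↑(aUnit k q)⁻¹, mem_CA.2 (Commute.refl _).units_inv_right⟩
  val_inv := Subtype.ext (aUnit k q).mul_inv
  inv_val := Subtype.ext (aUnit k q).inv_mul

/-- `E a²` as an element of the centralizer of `a`. -/
def e : CA k q := ⟨Dq.e k q, mem_CA.2 (isTorusWeyl k q).ae⟩

/-- `c K⁻¹ a⁻¹` as an element of the centralizer of `a`. -/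
def y : CA k q := ⟨Dq.y k q, mem_CA.2 (isTorusWeyl k q).ay⟩

/-- `b K⁻¹ a` as an element of the centralizer of `a`. -/
def z : CA k q := ⟨Dq.z k q, mem_CA.2 (isTorusWeyl k q).az⟩

/-- `F K a⁻²` as an element of the centralizer of `a`. -/
def f : CA k q := ⟨Dq.f k q, mem_CA.2 (isTorusWeyl k q).af⟩

theorem isWeylPair : IsWeylPair q (e k q) (y k q) (z k q) (f k q) where
  ey := Subtype.ext (Dq.isWeylPair k q).ey
  fz := Subtype.ext (Dq.isWeylPair k q).fz
  ez := Subtype.ext (Dq.isWeylPair k q).ez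
  ef := Subtype.ext (Dq.isWeylPair k q).ef
  zy := Subtype.ext (Dq.isWeylPair k q).zy
  yf := Subtype.ext (Dq.isWeylPair k q).yf

variable {k q} in
theorem commute_a (t : CA k q) : Commute (a k q : CA k q) t :=
  Subtype.ext (mem_CA.1 t.2)

theorem isReorderable :
    IsReorderable k ![(↑(a k q)⁻¹ : CA k q), y k q, e k q, z k q, f k q] := by
  have h := isWeylPair k q
  have ey : e k q * y k q = q ^ 2 • (y k q * e k q) + (1 : k) • 1 := by rw [h.ey, one_smul]
  have of_qcommute {s : kˣ} {u v : CA k q} (huv : QCommute s u v) :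
      ∃ (s : kˣ) (t : k), u * v = s • (v * u) + t • 1 :=
    ⟨s, 0, by rw [huv, zero_smul, add_zero]⟩
  have inv_a (t : CA k q) := of_qcommute (.of_commute (commute_a t).units_inv_left.symm)
  intro i j hij
  fin_cases i <;> fin_cases j <;> first | exact absurd hij (by decide) | skip
  exacts [inv_a _, inv_a _, inv_a _, inv_a _, ⟨_, _, ey⟩, of_qcommute h.zy, of_qcommute h.yf.symm,
    of_qcommute h.ez.symm, of_qcommute h.ef.symm, ⟨_, _, h.fz⟩]

variable {k q} in
theorem adjoin_eq_top (hq : ¬ IsOfFinOrder q) : Algebra.adjoin k (insert (a k q : CA k q)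
    (Set.range ![(↑(a k q)⁻¹ : CA k q), y k q, e k q, z k q, f k q])) = ⊤ := by
  apply Subalgebra.map_injective (f := (CA k q).val) Subtype.val_injective
  rw [← Algebra.adjoin_image, Algebra.map_top, Subalgebra.range_val]
  refine Eq.trans ?_ (CA_eq_torusCentralizer hq).symm
  simp only [torusCentralizer, Matrix.range_cons, Matrix.range_empty, Set.union_empty,
    Set.singleton_union, Set.insert_comm (y k q) (e k q), Set.image_insert_eq, Set.image_singleton]
  rfl

/-- The element `a` acts on the `C(a, D_q)`-module `M` as the scalar `μ`. -/
def HasWeight (M : Type*) [AddCommGroup M] [Module (CA k q) M] (μ : kˣ) : Prop :=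
  ∀ m : M, (a k q : CA k q) • m = algebraMap k (CA k q) μ • m

variable {k q}

theorem exists_hasWeight [IsAlgClosed k] (hq : ¬ IsOfFinOrder q) (M : Type*) [AddCommGroup M]
    [Module (CA k q) M] [IsSimpleModule (CA k q) M] : ∃ μ : kˣ, HasWeight k q M μ := by
  let : Module k M := Module.compHom M (algebraMap k (CA k q))
  have : IsScalarTower k (CA k q) M := .of_algebraMap_smul fun _ _ => rfl
  have a_mem_center : (a k q : CA k q) ∈ Subalgebra.center k (CA k q) :=
    Subalgebra.mem_center_iff.2 fun t => (commute_a t).symm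
  obtain ⟨c, hc⟩ := (isReorderable k q).exists_smul_eq_of_mem_center a_mem_center
    (adjoin_eq_top hq) M
  have hc0 : c ≠ 0 := by
    rintro rfl
    have : Nontrivial M := IsSimpleModule.nontrivial (CA k q) M
    obtain ⟨m, hm⟩ := exists_ne (0 : M)
    exact hm ((smul_eq_zero_iff_eq (a k q)).1 ((hc m).trans (zero_smul k m)))
  exact ⟨Units.mk0 c hc0, hc⟩

end CA

end CentralCharacter

section QuantumWeyl

variable {k : Type*} [Field k] {s : kˣ}

theorem injective_geom_sum (hs : ¬ IsOfFinOrder s) :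
    Function.Injective fun n : ℕ => ∑ i ∈ Finset.range n, (s : k) ^ i := by
  intro m n hmn
  have hpow : (s : k) ^ m = (s : k) ^ n := by
    rw [← sub_left_inj (a := 1), ← mul_geom_sum, ← mul_geom_sum]
    exact congrArg _ hmn
  exact injective_pow_iff_not_isOfFinOrder.2 hs (Units.ext (by simpa using hpow))

/-- The nonzero spectra of `e y` and `y e` agree, so the spectrum of `y e` would contain with `0`
the whole orbit `t (1 + s + ⋯ + sⁿ⁻¹)` of `c ↦ s c + t`. -/
theorem isUnit_mul_of_quantum_weyl {A : Type*} [Ring A] [Algebra k A] {e y : A} {t : k}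
    (hs : ¬ IsOfFinOrder s) (ht : t ≠ 0) (h : e * y = s • (y * e) + t • 1)
    (hfin : (spectrum k (y * e)).Finite) : IsUnit (y * e) := by
  rw [← spectrum.zero_notMem_iff k]
  intro zero_mem
  let c (n : ℕ) : k := t * ∑ i ∈ Finset.range n, (s : k) ^ i
  have c_injective : Function.Injective c := (mul_right_injective₀ ht).comp (injective_geom_sum hs)
  have c_zero : c 0 = 0 := by simp [c]
  have c_succ (n : ℕ) : c (n + 1) = s • c n + t := by
    simp only [c, geom_sum_succ, Units.smul_def, smul_eq_mul]
    ring
  have c_mem (n : ℕ) : c n ∈ spectrum k (y * e) := by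
    induction n with
    | zero => rwa [c_zero]
    | succ n ih =>
      have mem_spectrum : c (n + 1) ∈ spectrum k (e * y) := by
        rw [h, ← Algebra.algebraMap_eq_smul_one, ← spectrum.add_singleton_eq,
          spectrum.unit_smul_eq_smul, c_succ]
        exact Set.add_mem_add (Set.smul_mem_smul_set ih) rfl
      have c_ne_zero : c (n + 1) ≠ 0 := c_zero ▸ c_injective.ne n.succ_ne_zero
      have mem_diff : c (n + 1) ∈ spectrum k (e * y) \ {0} := ⟨mem_spectrum, c_ne_zero⟩
      rw [spectrum.nonzero_mul_comm] at mem_diff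
      exact mem_diff.1
  exact Set.infinite_of_injective_forall_mem c_injective c_mem hfin

variable {W : Type*} [AddCommGroup W] [Module k W]

theorem QCommute.pow_finrank_eq_one {u v : Module.End k W} (h : QCommute s u v)
    (hu : LinearMap.det u ≠ 0) (hv : LinearMap.det v ≠ 0) : s ^ Module.finrank k W = 1 := by
  have hdet := congrArg LinearMap.det h
  rw [Units.smul_def, map_mul, LinearMap.det_smul, map_mul,
    mul_comm (LinearMap.det v)] at hdet
  exact Units.ext ((mul_eq_right₀ (mul_ne_zero hu hv)).1 hdet.symm)

theorem IsWeylPair.not_finiteDimensional [Nontrivial W] {q : kˣ} (hq : ¬ IsOfFinOrder q)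
    {e y z f : Module.End k W} (h : IsWeylPair q e y z f) : ¬ FiniteDimensional k W := by
  intro _
  have not_isOfFinOrder_sq : ¬ IsOfFinOrder (q ^ 2) := fun h2 => hq (h2.of_pow two_ne_zero)
  have not_isOfFinOrder_zpow_neg_two : ¬ IsOfFinOrder (q ^ (-2 : ℤ)) := by
    rwa [zpow_neg, isOfFinOrder_inv_iff]
  have det_ne_zero {u v : Module.End k W} {s : kˣ} {t : k} (hs : ¬ IsOfFinOrder s) (ht : t ≠ 0)
      (huv : u * v = s • (v * u) + t • 1) : LinearMap.det u ≠ 0 := by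
    have isUnit := isUnit_mul_of_quantum_weyl hs ht huv (Module.End.finite_spectrum _)
    have isUnit_det := isUnit.map (LinearMap.det (M := W))
    rw [map_mul] at isUnit_det
    exact (isUnit_of_mul_isUnit_right isUnit_det).ne_zero
  have det_e : LinearMap.det e ≠ 0 :=
    det_ne_zero (t := 1) not_isOfFinOrder_sq one_ne_zero (by rw [one_smul]; exact h.ey)
  have det_f : LinearMap.det f ≠ 0 := det_ne_zero not_isOfFinOrder_zpow_neg_two q.ne_zero h.fz
  exact not_isOfFinOrder_zpow_neg_two (isOfFinOrder_iff_pow_eq_one.2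
    ⟨_, Module.finrank_pos, h.ef.pow_finrank_eq_one det_e det_f⟩)

end QuantumWeyl

section WeightModules

variable {k : Type u} [Field k] {q : kˣ} {V : Type v} [AddCommGroup V] [Module k V]
  [Module (Dq k q) V] [IsScalarTower k (Dq k q) V]

theorem iSupIndep_weightSpace : iSupIndep (weightSpace k q V) :=
  (Module.End.eigenspaces_iSupIndep (Algebra.lsmul k k V (Dq.of k q .a))).comp Units.val_injective

theorem iSupIndep_weightSpace_orbit (hq : ¬ IsOfFinOrder q) (μ : kˣ) :
    iSupIndep fun i : ℤ => weightSpace k q V (q ^ i * μ) :=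
  iSupIndep_weightSpace.comp fun _ _ h =>
    injective_zpow_iff_not_isOfFinOrder.2 hq (mul_right_cancel h)

theorem isAWeight_iff_iSup_eq_top : IsAWeight k q V ↔ ⨆ μ, weightSpace k q V μ = ⊤ := by
  classical
  rw [IsAWeight]
  convert DirectSum.isInternal_submodule_iff_iSupIndep_and_iSup_eq_top (weightSpace k q V)
  exact (and_iff_right iSupIndep_weightSpace).symm

theorem isAWeight_of_iSup_orbit_eq_top {μ : kˣ}
    (h : ⨆ i : ℤ, weightSpace k q V (q ^ i * μ) = ⊤) : IsAWeight k q V :=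
  isAWeight_iff_iSup_eq_top.2 <| top_le_iff.1 <| h.ge.trans <|
    iSup_le fun i => le_iSup (weightSpace k q V) (q ^ i * μ)

theorem supp_nonempty [Nontrivial V] (h : IsAWeight k q V) : (supp k q V).Nonempty := by
  by_contra hempty
  have hbot (μ : kˣ) : weightSpace k q V μ = ⊥ :=
    of_not_not fun hμ => hempty ⟨μ, hμ⟩
  rw [isAWeight_iff_iSup_eq_top] at h
  simp only [hbot, iSup_bot] at h
  exact bot_ne_top h

/-- The images in `V ⧸ N` of the weight components of `x ∈ N` are weight vectors of distinct
weights with sum zero, so all the components lie in `N`. -/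
theorem exists_mem_weightSpace_of_ne_bot (h : IsAWeight k q V) {N : Submodule (Dq k q) V}
    (hN : N ≠ ⊥) : ∃ μ, ∃ x ∈ weightSpace k q V μ, x ∈ N ∧ x ≠ 0 := by
  obtain ⟨x, hxN, hx0⟩ := Submodule.exists_mem_ne_zero_of_ne_bot hN
  have hx : x ∈ ⨆ μ, weightSpace k q V μ := isAWeight_iff_iSup_eq_top.1 h ▸ Submodule.mem_top
  obtain ⟨c, hc, rfl⟩ := (Submodule.mem_iSup_iff_exists_finsupp _ _).1 hx
  have mk_mem (μ : kˣ) : N.mkQ (c μ) ∈ weightSpace k q (V ⧸ N) μ := by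
    rw [mem_weightSpace, ← map_smul, (mem_weightSpace k q V μ _).1 (hc μ)]
    exact N.mkQ.map_smul_of_tower (μ : k) (c μ)
  have mem_N (μ) (hμ : μ ∈ c.support) : c μ ∈ N := by
    refine (Submodule.Quotient.mk_eq_zero N).1 <|
      (iSupIndep_iff_finsetSum_eq_zero_imp_eq_zero _).1 iSupIndep_weightSpace c.support
        (fun μ => N.mkQ (c μ)) (fun μ _ => mk_mem μ) ?_ μ hμ
    rw [← map_sum]
    exact (Submodule.Quotient.mk_eq_zero N).2 hxN
  obtain ⟨μ, hμ⟩ : c.support.Nonempty :=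
    Finsupp.support_nonempty_iff.2 (by rintro rfl; exact hx0 Finsupp.sum_zero_index)
  exact ⟨μ, c μ, hc μ, mem_N μ hμ, Finsupp.mem_support_iff.1 hμ⟩

theorem smul_mem_weightSpace {i : ℤ} {d : Dq k q} (hd : d ∈ Dq.gr k q i) {μ : kˣ} {x : V}
    (hx : x ∈ weightSpace k q V μ) : d • x ∈ weightSpace k q V (q ^ i * μ) := by
  rw [mem_weightSpace] at hx ⊢
  calc Dq.of k q .a • d • x
      = (q ^ i • (d * Dq.of k q .a)) • x :=
        (mul_smul _ d x).symm.trans (congrArg (· • x) (Dq.mem_gr.1 hd))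
    _ = ((q ^ i : kˣ) : k) • d • (μ : k) • x := by rw [Units.smul_def, smul_assoc, mul_smul, hx]
    _ = ((q ^ i * μ : kˣ) : k) • d • x := by rw [smul_comm d, smul_smul, Units.val_mul]

theorem mem_supp_of_mem {μ : kˣ} {x : V} (hx : x ∈ weightSpace k q V μ) (hx0 : x ≠ 0) :
    μ ∈ supp k q V :=
  (Submodule.ne_bot_iff _).2 ⟨x, hx, hx0⟩

theorem zpow_mul_mem_supp {μ : kˣ} (hμ : μ ∈ supp k q V) (i : ℤ) : q ^ i * μ ∈ supp k q V := by
  obtain ⟨x, hx, hx0⟩ := Submodule.exists_mem_ne_zero_of_ne_bot hμ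
  exact mem_supp_of_mem (smul_mem_weightSpace (Dq.KUnit_zpow_mem_gr k q i) hx)
    ((smul_ne_zero_iff_ne (Dq.KUnit k q ^ i)).2 hx0)

theorem iSup_orbit_eq_top_of_span_eq_top {μ : kˣ} {s : Set V} (hs : s ⊆ weightSpace k q V μ)
    (hspan : Submodule.span (Dq k q) s = ⊤) : ⨆ i : ℤ, weightSpace k q V (q ^ i * μ) = ⊤ := by
  refine Submodule.eq_top_iff'.2 fun x => ?_
  have hx : x ∈ Submodule.span (Dq k q) s := hspan ▸ Submodule.mem_top
  induction hx using Submodule.closure_induction with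
  | zero => exact zero_mem _
  | add x y _ _ hx hy => exact add_mem hx hy
  | smul_mem d x hx =>
    have hd : d ∈ ⨆ i, Dq.gr k q i := Dq.iSup_gr k q ▸ Submodule.mem_top
    induction hd using Submodule.iSup_induction' with
    | mem i d hd => exact Submodule.mem_iSup_of_mem i (smul_mem_weightSpace hd (hs hx))
    | zero => exact zero_smul (Dq k q) x ▸ zero_mem _
    | add d d' _ _ h h' => exact add_smul d d' x ▸ add_mem h h'

theorem mem_range_of_mem_supp {μ ν : kˣ} (h : ⨆ i : ℤ, weightSpace k q V (q ^ i * μ) = ⊤)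
    (hν : ν ∈ supp k q V) : ν ∈ Set.range fun i : ℤ => q ^ i * μ := by
  by_contra hne
  have hdisj : Disjoint (weightSpace k q V ν) (⨆ ν' ∈ Set.range fun i : ℤ => q ^ i * μ,
      weightSpace k q V ν') := iSupIndep_weightSpace.disjoint_biSup hne
  rw [iSup_range, h, disjoint_top] at hdisj
  exact hν hdisj

theorem span_weightSpace_eq_top [IsSimpleModule (Dq k q) V] {μ : kˣ} (hμ : μ ∈ supp k q V) :
    Submodule.span (Dq k q) (weightSpace k q V μ : Set V) = ⊤ := by
  obtain ⟨x, hx, hx0⟩ := Submodule.exists_mem_ne_zero_of_ne_bot hμ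
  exact (eq_bot_or_eq_top _).resolve_left fun hbot => hx0 (Submodule.span_eq_bot.1 hbot x hx)

theorem supp_eq_range [IsSimpleModule (Dq k q) V] {μ : kˣ} (hμ : μ ∈ supp k q V) :
    supp k q V = Set.range fun i : ℤ => q ^ i * μ := by
  refine Set.Subset.antisymm (fun ν => mem_range_of_mem_supp
    (iSup_orbit_eq_top_of_span_eq_top subset_rfl (span_weightSpace_eq_top hμ))) ?_
  rintro _ ⟨i, rfl⟩
  exact zpow_mul_mem_supp hμ i

variable (q V) in
/-- The weight space `V_μ` as a `C(a, D_q)`-submodule of `V`. -/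
def weightSubmodule (μ : kˣ) : Submodule (CA k q) V :=
  { weightSpace k q V μ with
    smul_mem' := fun t _ hx => by
      have htx := smul_mem_weightSpace (Dq.mem_gr_zero.2 t.2) hx
      rwa [zpow_zero, one_mul] at htx }

/-- Modulo the other weight spaces, only the degree zero part `C(a, D_q)` of `D_q` contributes to
the component of weight `μ` of `D_q W`. -/
theorem eq_weightSubmodule_of_span_eq_top (hq : ¬ IsOfFinOrder q) {μ : kˣ}
    {W : Submodule (CA k q) V} (hW : W ≤ weightSubmodule q V μ)
    (hspan : Submodule.span (Dq k q) (W : Set V) = ⊤) : W = weightSubmodule q V μ := by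
  let U : Submodule k V := ⨆ (j : ℤ) (_ : j ≠ 0), weightSpace k q V (q ^ j * μ)
  have smul_mem_sup (d : Dq k q) (w) (hw : w ∈ W) : d • w ∈ W.restrictScalars k ⊔ U := by
    have hd : d ∈ ⨆ i, Dq.gr k q i := Dq.iSup_gr k q ▸ Submodule.mem_top
    induction hd using Submodule.iSup_induction' with
    | mem j d hd =>
      by_cases hj : j = 0
      · subst hj
        exact Submodule.mem_sup_left (W.smul_mem (⟨d, Dq.mem_gr_zero.1 hd⟩ : CA k q) hw)
      · exact Submodule.mem_sup_right (Submodule.mem_iSup_of_mem j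
          (Submodule.mem_iSup_of_mem hj (smul_mem_weightSpace hd (hW hw))))
    | zero => exact zero_smul (Dq k q) w ▸ zero_mem _
    | add d d' _ _ h h' => exact add_smul d d' w ▸ add_mem h h'
  have mem_sup (x : V) : x ∈ W.restrictScalars k ⊔ U := by
    have hx : x ∈ Submodule.span (Dq k q) (W : Set V) := hspan ▸ Submodule.mem_top
    induction hx using Submodule.closure_induction with
    | zero => exact zero_mem _
    | add x y _ _ hx hy => exact add_mem hx hy
    | smul_mem d w hw => exact smul_mem_sup d w hw
  refine hW.antisymm fun x hx => ?_
  obtain ⟨w, hw, r, hr, rfl⟩ := Submodule.mem_sup.1 (mem_sup x)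
  have hr' : r ∈ weightSpace k q V (q ^ (0 : ℤ) * μ) := by
    rw [zpow_zero, one_mul]
    exact (add_mem_cancel_left (hW hw)).1 hx
  rwa [Submodule.disjoint_def.1 (iSupIndep_weightSpace_orbit hq μ 0) r hr' hr, add_zero]

theorem isSimpleModule_weightSubmodule (hq : ¬ IsOfFinOrder q) [IsSimpleModule (Dq k q) V]
    {μ : kˣ} (hμ : μ ∈ supp k q V) : IsSimpleModule (CA k q) (weightSubmodule q V μ) := by
  refine isSimpleModule_iff_toSpanSingleton_surjective.2
    ⟨(Submodule.nontrivial_iff_ne_bot (p := weightSpace k q V μ)).2 hμ, fun n hn x => ?_⟩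
  have hn0 : (n : V) ≠ 0 := fun h => hn (Subtype.ext h)
  have span_eq : Submodule.span (CA k q) {(n : V)} = weightSubmodule q V μ := by
    refine eq_weightSubmodule_of_span_eq_top hq
      ((Submodule.span_singleton_le_iff_mem _ _).2 n.2)
      ((eq_bot_or_eq_top _).resolve_left fun hbot => hn0 ?_)
    exact Submodule.span_eq_bot.1 hbot n (Submodule.mem_span_singleton_self _)
  obtain ⟨t, ht⟩ := Submodule.mem_span_singleton.1 (span_eq.ge x.2)
  exact ⟨t, Subtype.ext ht⟩

theorem isSimpleModule_of_isSimpleModule_weightSubmodule {μ : kˣ}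
    [IsSimpleModule (CA k q) (weightSubmodule q V μ)]
    (hspan : Submodule.span (Dq k q) (weightSpace k q V μ : Set V) = ⊤) :
    IsSimpleModule (Dq k q) V := by
  have iSup_eq_top := iSup_orbit_eq_top_of_span_eq_top subset_rfl hspan
  have eq_top (N : Submodule (Dq k q) V) (hN : N ≠ ⊥) : N = ⊤ := by
    obtain ⟨ν, x, hx, hxN, hx0⟩ :=
      exists_mem_weightSpace_of_ne_bot (isAWeight_of_iSup_orbit_eq_top iSup_eq_top) hN
    obtain ⟨i, rfl⟩ := mem_range_of_mem_supp iSup_eq_top (mem_supp_of_mem hx hx0)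
    have hy : (↑(Dq.KUnit k q ^ (-i)) : Dq k q) • x ∈ weightSpace k q V μ := by
      simpa only [← mul_assoc, ← zpow_add, neg_add_cancel, zpow_zero, one_mul]
        using smul_mem_weightSpace (Dq.KUnit_zpow_mem_gr k q (-i)) hx
    let y : weightSubmodule q V μ := ⟨_, hy⟩
    have hy0 : y ≠ 0 := fun h =>
      (smul_ne_zero_iff_ne (Dq.KUnit k q ^ (-i))).2 hx0 (congrArg Subtype.val h)
    refine top_le_iff.1 (hspan.ge.trans (Submodule.span_le.2 fun z hz => ?_))
    obtain ⟨t, ht⟩ := IsSimpleModule.toSpanSingleton_surjective (CA k q) hy0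
      (⟨z, hz⟩ : weightSubmodule q V μ)
    have smul_y_eq : (t : Dq k q) • (y : V) = z := congrArg Subtype.val ht
    exact smul_y_eq ▸ N.smul_mem (t : Dq k q) (N.smul_mem _ hxN)
  have : Nontrivial (weightSubmodule q V μ) := IsSimpleModule.nontrivial (CA k q) _
  have : Nontrivial V := Subtype.val_injective.nontrivial (α := weightSubmodule q V μ)
  exact { eq_bot_or_eq_top := fun N => or_iff_not_imp_left.2 (eq_top N) }

theorem not_finiteDimensional_weightSpace (hq : ¬ IsOfFinOrder q) {μ : kˣ}
    (hμ : μ ∈ supp k q V) : ¬ FiniteDimensional k (weightSpace k q V μ) := by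
  have : Nontrivial (weightSpace k q V μ) := Submodule.nontrivial_iff_ne_bot.2 hμ
  have : Nontrivial (weightSubmodule q V μ) := this
  exact ((CA.isWeylPair k q).map
    (Algebra.lsmul k k (weightSubmodule q V μ))).not_finiteDimensional hq

end WeightModules

section InducedModules

namespace Ind

variable {k : Type u} [Field k] {D : Type u} [Ring D] [Algebra k D] (S : Subalgebra k D)
  (M : Type v) [AddCommGroup M] [Module S M]

/-- The unit `m ↦ 1 ⊗ m` of the adjunction between induction from `S` to `D` and restriction. -/
def unit : M →ₗ[S] Ind S M where
  toFun m := Submodule.Quotient.mk ((1 : D) ⊗ₜ[ℤ] m)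
  map_add' m m' := congrArg Submodule.Quotient.mk (TensorProduct.tmul_add (1 : D) m m')
  map_smul' s m := by
    have h : ((s : D) * 1) ⊗ₜ[ℤ] m - (1 : D) ⊗ₜ[ℤ] (s • m) ∈ balancedRel S M :=
      Submodule.subset_span ⟨1, s, m, by rw [mul_one, one_mul]⟩
    exact ((Submodule.Quotient.eq _).2 h).symm

theorem smul_unit (d : D) (m : M) :
    d • unit S M m = (Submodule.Quotient.mk (d ⊗ₜ[ℤ] m) : (D ⊗[ℤ] M) ⧸ balancedRel S M) :=
  congrArg (Submodule.Quotient.mk (p := balancedRel S M))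
    ((TensorProduct.smul_tmul' d (1 : D) m).trans (by rw [smul_eq_mul, mul_one]))

theorem span_range_unit : Submodule.span D (Set.range (unit S M)) = ⊤ := by
  refine Submodule.eq_top_iff'.2 fun x => ?_
  obtain ⟨t, rfl⟩ := Submodule.Quotient.mk_surjective (balancedRel S M) x
  induction t using TensorProduct.induction_on with
  | zero => exact zero_mem _
  | tmul d m =>
    rw [← smul_unit]
    exact Submodule.smul_mem _ d (Submodule.subset_span ⟨m, rfl⟩)
  | add t t' h h' => exact add_mem h h'

variable {S M}

/-- Frobenius reciprocity: the extension of an `S`-linear map `g : M → V` to the `D`-linear map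
`d ⊗ m ↦ d g(m)`. -/
def lift {V : Type*} [AddCommGroup V] [Module D V] (g : M →ₗ[S] V) : Ind S M →ₗ[D] V :=
  (balancedRel S M).liftQ
    (TensorProduct.AlgebraTensorModule.lift
      (LinearMap.toSpanSingleton D (M →ₗ[ℤ] V) g.toAddMonoidHom.toIntLinearMap)) <| by
    refine Submodule.span_le.2 ?_
    rintro _ ⟨d, s, m, rfl⟩
    refine LinearMap.mem_ker.2 ((map_sub _ _ _).trans (sub_eq_zero.2 ?_))
    change (d * (s : D)) • g m = d • g (s • m)
    rw [map_smul, mul_smul]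
    rfl

theorem lift_unit {V : Type*} [AddCommGroup V] [Module D V] (g : M →ₗ[S] V) (m : M) :
    lift g (unit S M m) = g m :=
  one_smul D (g m)

/-- The retraction makes `d ⊗ m ↦ p(d) m` well defined; it recovers `m` from `1 ⊗ m`. -/
theorem unit_injective_of_retraction (p : D →+ S) (p_one : p 1 = 1)
    (p_mul : ∀ (d : D) (s : S), p (d * s) = p d * s) : Function.Injective (unit S M) := by
  let φ : D ⊗[ℤ] M →+ M := TensorProduct.liftAddHom ((smulAddHom S M).comp p)
    fun r d m => by rw [map_zsmul, map_zsmul, AddMonoidHom.smul_apply]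
  have φ_tmul (d : D) (m : M) : φ (d ⊗ₜ m) = p d • m := rfl
  have φ_smul_eq_zero {x : D ⊗[ℤ] M} (hx : x ∈ balancedRel S M) (d : D) : φ (d • x) = 0 := by
    induction hx using Submodule.span_induction generalizing d with
    | mem x hx =>
      obtain ⟨d', s, m, rfl⟩ := hx
      rw [smul_sub, TensorProduct.smul_tmul', TensorProduct.smul_tmul', map_sub, φ_tmul, φ_tmul,
        smul_eq_mul, smul_eq_mul, ← mul_assoc, p_mul, mul_smul, sub_self]
    | zero => rw [smul_zero, map_zero]
    | add x y _ _ hx hy => rw [smul_add, map_add, hx, hy, add_zero]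
    | smul c x _ hx => rw [smul_smul]; exact hx _
  refine (injective_iff_map_eq_zero _).2 fun m hm => ?_
  have h := φ_smul_eq_zero ((Submodule.Quotient.mk_eq_zero _).1 hm) 1
  rwa [one_smul, φ_tmul, p_one, one_smul] at h

end Ind

section Twist

variable {k R : Type*} [CommRing k] [Ring R] [Algebra k R] (σ : R ≃ₐ[k] R)
  (M : Type v) [AddCommGroup M] [Module R M]

/-- The identity map of the underlying abelian group, as a `σ`-semilinear map from the twist `M^σ`
to `M`. -/
def untwist : Twist σ M →ₛₗ[(σ : R →+* R)] M where
  toFun m := m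
  map_add' _ _ := rfl
  map_smul' _ _ := rfl

theorem untwist_bijective : Function.Bijective (untwist σ M) :=
  Function.bijective_id

end Twist

variable {k : Type u} [Field k] {q : kˣ}

theorem KUnit_zpow_mul_tauK_zpow (i : ℤ) (t : CA k q) :
    (↑(Dq.KUnit k q ^ i) : Dq k q) * (tauK k q ^ i) t = t * ↑(Dq.KUnit k q ^ i) := by
  have K_mul_tauK (t : CA k q) : (Dq.KUnit k q : Dq k q) * tauK k q t = t * Dq.KUnit k q := by
    change (Dq.KUnit k q : Dq k q) * (↑(Dq.KUnit k q)⁻¹ * t * ↑(Dq.KUnit k q)) = _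
    rw [mul_assoc, Units.mul_inv_cancel_left]
  have Kinv_mul_tauK_inv (t : CA k q) :
      (↑(Dq.KUnit k q)⁻¹ : Dq k q) * (tauK k q)⁻¹ t = t * ↑(Dq.KUnit k q)⁻¹ := by
    change (↑(Dq.KUnit k q)⁻¹ : Dq k q) * (↑(Dq.KUnit k q) * t * ↑(Dq.KUnit k q)⁻¹) = _
    rw [mul_assoc, Units.inv_mul_cancel_left]
  induction i generalizing t with
  | zero => simp only [zpow_zero, Units.val_one, one_mul, mul_one, AlgEquiv.one_apply]
  | succ n ih =>
    rw [zpow_add_one (tauK k q), AlgEquiv.mul_apply, zpow_add_one (Dq.KUnit k q),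
      (Commute.zpow_self (Dq.KUnit k q) n).eq, Units.val_mul, mul_assoc, ih, ← mul_assoc,
      K_mul_tauK, mul_assoc]
  | pred n ih =>
    rw [zpow_sub_one (tauK k q), AlgEquiv.mul_apply, zpow_sub_one (Dq.KUnit k q),
      ((Commute.zpow_self (Dq.KUnit k q) (-n)).inv_right).eq, Units.val_mul, mul_assoc, ih,
      ← mul_assoc, Kinv_mul_tauK_inv, mul_assoc]

section InducedWeights

variable {M : Type v} [AddCommGroup M] [Module (CA k q) M]

theorem unit_injective (hq : ¬ IsOfFinOrder q) : Function.Injective (Ind.unit (CA k q) M) := by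
  obtain ⟨p, p_one, p_mul⟩ := Dq.exists_retraction_CA hq
  exact Ind.unit_injective_of_retraction p p_one p_mul

variable (M) in
/-- The map `m ↦ Kⁱ ⊗ m`, which is `C(a, D_q)`-linear on the twist of `M` by `τ_Kⁱ`. -/
def twistUnit (i : ℤ) : Twist (tauK k q ^ i) M →ₗ[CA k q] Ind (CA k q) M where
  toFun m := (↑(Dq.KUnit k q ^ i) : Dq k q) • Ind.unit (CA k q) M (untwist _ M m)
  map_add' m m' := by rw [map_add, map_add, smul_add]
  map_smul' t m := by
    rw [map_smulₛₗ, map_smul, RingHom.id_apply]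
    calc (↑(Dq.KUnit k q ^ i) : Dq k q) • (((tauK k q ^ i) t : CA k q) : Dq k q) •
          Ind.unit (CA k q) M (untwist _ M m)
        = ((t : Dq k q) * ↑(Dq.KUnit k q ^ i)) • Ind.unit (CA k q) M (untwist _ M m) := by
          rw [smul_smul, KUnit_zpow_mul_tauK_zpow]
      _ = (t : Dq k q) • (↑(Dq.KUnit k q ^ i) : Dq k q) •
          Ind.unit (CA k q) M (untwist _ M m) := mul_smul _ _ _

theorem twistUnit_injective (hq : ¬ IsOfFinOrder q) (i : ℤ) :
    Function.Injective (twistUnit (q := q) M i) := fun _ _ h =>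
  (untwist_bijective _ M).injective (unit_injective hq (MulAction.injective (Dq.KUnit k q ^ i) h))

theorem span_range_twistUnit (i : ℤ) :
    Submodule.span (Dq k q) (Set.range (twistUnit (q := q) M i)) = ⊤ := by
  refine top_le_iff.1 ((Ind.span_range_unit (CA k q) M).ge.trans (Submodule.span_le.2 ?_))
  rintro _ ⟨m, rfl⟩
  obtain ⟨m, rfl⟩ := (untwist_bijective (tauK k q ^ i) M).surjective m
  have twistUnit_mem := Submodule.smul_mem _ (↑(Dq.KUnit k q ^ i)⁻¹ : Dq k q)
    (Submodule.subset_span (R := Dq k q) (Set.mem_range_self (f := twistUnit (q := q) M i) m))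
  exact inv_smul_smul (Dq.KUnit k q ^ i) (Ind.unit (CA k q) M _) ▸ twistUnit_mem

variable {V : Type*} [AddCommGroup V] [Module k V] [Module (Dq k q) V]
  [IsScalarTower k (Dq k q) V]

theorem hasWeight_weightSubmodule (μ : kˣ) :
    CA.HasWeight k q (weightSubmodule q V μ) μ := by
  rintro ⟨x, hx⟩
  exact Subtype.ext (((mem_weightSpace k q V μ x).1 hx).trans (algebraMap_smul _ _ x).symm)

theorem CA.HasWeight.map_mem_weightSpace {μ : kˣ} (hμ : CA.HasWeight k q M μ) (g : M →ₗ[CA k q] V)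
    (m : M) : g m ∈ weightSpace k q V μ := by
  rw [mem_weightSpace]
  calc Dq.of k q .a • g m = g ((CA.a k q : CA k q) • m) := (g.map_smul (CA.a k q : CA k q) m).symm
    _ = (algebraMap k (CA k q) μ) • g m := by rw [hμ, map_smul]
    _ = (μ : k) • g m := algebraMap_smul (CA k q) (μ : k) (g m)

theorem CA.HasWeight.of_injective {N : Type*} [AddCommGroup N] [Module (CA k q) N] {μ : kˣ}
    (hμ : CA.HasWeight k q N μ) {g : M →ₗ[CA k q] N} (hg : Function.Injective g) :
    CA.HasWeight k q M μ :=
  fun m => hg (by rw [map_smul, map_smul, hμ])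

variable {μ : kˣ}

theorem CA.HasWeight.twistUnit_mem (hμ : CA.HasWeight k q M μ) (i : ℤ)
    (m : Twist (tauK k q ^ i) M) :
    twistUnit M i m ∈ weightSpace k q (Ind (CA k q) M) (q ^ i * μ) :=
  smul_mem_weightSpace (Dq.KUnit_zpow_mem_gr k q i) (hμ.map_mem_weightSpace _ _)

/-- For `M` of weight `μ`, the map `m ↦ 1 ⊗ m` identifies `M` with the weight space of weight `μ`
of the induced module. -/
noncomputable def equivWeightSubmodule (hq : ¬ IsOfFinOrder q) (hμ : CA.HasWeight k q M μ) :
    M ≃ₗ[CA k q] weightSubmodule q (Ind (CA k q) M) μ :=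
  (LinearEquiv.ofInjective _ (unit_injective hq)).trans <| LinearEquiv.ofEq _ _ <|
    eq_weightSubmodule_of_span_eq_top hq
      (by rintro _ ⟨m, rfl⟩; exact hμ.map_mem_weightSpace _ m)
      (Ind.span_range_unit (CA k q) M)

/-- For `M` of weight `μ`, the map `m ↦ Kⁱ ⊗ m` identifies the twist of `M` by `τ_Kⁱ` with the
weight space of weight `qⁱ μ` of the induced module. -/
noncomputable def twistEquivWeightSubmodule (hq : ¬ IsOfFinOrder q)
    (hμ : CA.HasWeight k q M μ) (i : ℤ) :
    Twist (tauK k q ^ i) M ≃ₗ[CA k q] weightSubmodule q (Ind (CA k q) M) (q ^ i * μ) :=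
  (LinearEquiv.ofInjective _ (twistUnit_injective hq i)).trans <| LinearEquiv.ofEq _ _ <|
    eq_weightSubmodule_of_span_eq_top hq (by rintro _ ⟨m, rfl⟩; exact hμ.twistUnit_mem i m)
      (span_range_twistUnit i)

theorem iSup_weightSpace_ind_eq_top (hμ : CA.HasWeight k q M μ) :
    ⨆ i : ℤ, weightSpace k q (Ind (CA k q) M) (q ^ i * μ) = ⊤ :=
  iSup_orbit_eq_top_of_span_eq_top (by rintro _ ⟨m, rfl⟩; exact hμ.map_mem_weightSpace _ m)
    (Ind.span_range_unit (CA k q) M)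

theorem isSimpleModule_ind [IsSimpleModule (CA k q) M] (hq : ¬ IsOfFinOrder q)
    (hμ : CA.HasWeight k q M μ) : IsSimpleModule (Dq k q) (Ind (CA k q) M) := by
  have := IsSimpleModule.congr (equivWeightSubmodule hq hμ).symm
  refine isSimpleModule_of_isSimpleModule_weightSubmodule (μ := μ)
    (top_le_iff.1 ((Ind.span_range_unit (CA k q) M).ge.trans (Submodule.span_mono ?_)))
  rintro _ ⟨m, rfl⟩
  exact hμ.map_mem_weightSpace _ m

theorem map_mem_weightSpace_iff {V' : Type*} [AddCommGroup V'] [Module k V'] [Module (Dq k q) V']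
    [IsScalarTower k (Dq k q) V'] (φ : V ≃ₗ[Dq k q] V') {x : V} :
    φ x ∈ weightSpace k q V' μ ↔ x ∈ weightSpace k q V μ := by
  have map_smul_scalar : φ ((μ : k) • x) = (μ : k) • φ x :=
    φ.toLinearMap.map_smul_of_tower (μ : k) x
  rw [mem_weightSpace, mem_weightSpace, ← map_smul, ← map_smul_scalar, φ.injective.eq_iff]

/-- The restriction of an isomorphism of `D_q`-modules to the weight spaces of weight `μ`. -/
def weightSubmoduleCongr {V' : Type*} [AddCommGroup V'] [Module k V'] [Module (Dq k q) V']
    [IsScalarTower k (Dq k q) V'] (φ : V ≃ₗ[Dq k q] V') (μ : kˣ) :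
    weightSubmodule q V μ ≃ₗ[CA k q] weightSubmodule q V' μ :=
  (LinearEquiv.ofEq _ _ (Submodule.ext fun _ => (map_mem_weightSpace_iff φ).symm)).trans
    ((φ.restrictScalars (CA k q)).ofSubmodule' (weightSubmodule q V' μ))

theorem nonempty_ind_equiv_of_equiv_weightSubmodule [IsSimpleModule (CA k q) M]
    [IsSimpleModule (Dq k q) V] (hq : ¬ IsOfFinOrder q)
    (e : M ≃ₗ[CA k q] weightSubmodule q V μ) :
    Nonempty (Ind (CA k q) M ≃ₗ[Dq k q] V) := by
  have hM : CA.HasWeight k q M μ := (hasWeight_weightSubmodule μ).of_injective e.injective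
  have := isSimpleModule_ind hq hM
  have := IsSimpleModule.nontrivial (CA k q) M
  obtain ⟨m, hm⟩ := exists_ne (0 : M)
  let g : M →ₗ[CA k q] V := (weightSubmodule q V μ).subtype ∘ₗ e.toLinearMap
  have lift_ne_zero : Ind.lift g ≠ 0 := fun h => hm <| e.map_eq_zero_iff.1 <| Subtype.ext <|
    (Ind.lift_unit g m).symm.trans (LinearMap.congr_fun h _)
  exact ⟨LinearEquiv.ofBijective _ (LinearMap.bijective_of_ne_zero lift_ne_zero)⟩

theorem exists_equiv_twist_of_ind_equiv {M' : Type*} [AddCommGroup M'] [Module (CA k q) M']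
    [Nontrivial M'] (hq : ¬ IsOfFinOrder q) (hμ : CA.HasWeight k q M μ) {ν : kˣ}
    (hν : CA.HasWeight k q M' ν) (φ : Ind (CA k q) M ≃ₗ[Dq k q] Ind (CA k q) M') :
    ∃ i : ℤ, Nonempty (M' ≃ₗ[CA k q] Twist (tauK k q ^ i) M) := by
  let e : M' ≃ₗ[CA k q] weightSubmodule q (Ind (CA k q) M) ν :=
    (equivWeightSubmodule hq hν).trans (weightSubmoduleCongr φ ν).symm
  have ν_mem_supp : ν ∈ supp k q (Ind (CA k q) M) :=
    Submodule.nontrivial_iff_ne_bot.1 e.symm.toEquiv.surjective.nontrivial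
  obtain ⟨i, rfl⟩ := mem_range_of_mem_supp (iSup_weightSpace_ind_eq_top hμ) ν_mem_supp
  exact ⟨i, ⟨e.trans (twistEquivWeightSubmodule hq hμ i).symm⟩⟩

end InducedWeights

end InducedModules

end HeisenbergDouble

theorem mainTheorem11_general (k : Type u) [Field k] [IsAlgClosed k]
    (q : kˣ) (hq : ∀ n : ℕ, 0 < n → q ^ n ≠ 1) :
    (∀ (V : Type v) [AddCommGroup V] [Module k V] [Module (Dq k q) V]
        [IsScalarTower k (Dq k q) V],
      IsSimpleModule (Dq k q) V → IsAWeight k q V →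
        (supp k q V).Nonempty ∧
        ∀ μ ∈ supp k q V,
          supp k q V = Set.range (fun i : ℤ => q ^ i * μ) ∧
          ¬ FiniteDimensional k (weightSpace k q V μ)) ∧
    Nonempty (CA k q ≃ₐ[k] CK k q) ∧
    (∀ (M : Type v) [AddCommGroup M] [Module (CA k q) M],
      IsSimpleModule (CA k q) M →
        IsSimpleModule (Dq k q) (Ind (CA k q) M) ∧ IsAWeight k q (Ind (CA k q) M)) ∧
    (∀ (V : Type v) [AddCommGroup V] [Module k V] [Module (Dq k q) V]
        [IsScalarTower k (Dq k q) V],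
      IsSimpleModule (Dq k q) V → IsAWeight k q V →
        ∃ (M : Type v) (_ : AddCommGroup M) (_ : Module (CA k q) M),
          IsSimpleModule (CA k q) M ∧ Nonempty (Ind (CA k q) M ≃ₗ[Dq k q] V)) ∧
    (∀ (M M' : Type v) [AddCommGroup M] [Module (CA k q) M] [AddCommGroup M']
        [Module (CA k q) M'],
      IsSimpleModule (CA k q) M → IsSimpleModule (CA k q) M' →
        (Nonempty (Ind (CA k q) M ≃ₗ[Dq k q] Ind (CA k q) M') ↔
          ∃ i : ℤ, Nonempty (M' ≃ₗ[CA k q] Twist (tauK k q ^ i) M))) := by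
  have hq : ¬ IsOfFinOrder q := fun h =>
    have ⟨n, hn, hn1⟩ := isOfFinOrder_iff_pow_eq_one.1 h
    hq n hn hn1
  refine ⟨?_, Dq.nonempty_CA_equiv_CK k q, ?_, ?_, ?_⟩
  · intro V _ _ _ _ _ hV
    have := IsSimpleModule.nontrivial (Dq k q) V
    exact ⟨supp_nonempty hV, fun μ hμ =>
      ⟨supp_eq_range hμ, not_finiteDimensional_weightSpace hq hμ⟩⟩
  · intro M _ _ _
    obtain ⟨μ, hμ⟩ := CA.exists_hasWeight hq M
    exact ⟨isSimpleModule_ind hq hμ,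
      isAWeight_of_iSup_orbit_eq_top (iSup_weightSpace_ind_eq_top hμ)⟩
  · intro V _ _ _ _ _ hV
    have := IsSimpleModule.nontrivial (Dq k q) V
    obtain ⟨μ, hμ⟩ := supp_nonempty hV
    have := isSimpleModule_weightSubmodule hq hμ
    exact ⟨weightSubmodule q V μ, inferInstance, inferInstance, this,
      nonempty_ind_equiv_of_equiv_weightSubmodule hq (LinearEquiv.refl _ _)⟩
  · intro M M' _ _ _ _ _ _
    obtain ⟨μ, hμ⟩ := CA.exists_hasWeight hq M
    obtain ⟨ν, hν⟩ := CA.exists_hasWeight hq M'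
    have := IsSimpleModule.nontrivial (CA k q) M'
    refine ⟨fun ⟨φ⟩ => exists_equiv_twist_of_ind_equiv hq hμ hν φ, fun ⟨i, ⟨e⟩⟩ => ?_⟩
    have := isSimpleModule_ind hq hμ
    obtain ⟨φ⟩ := nonempty_ind_equiv_of_equiv_weightSubmodule hq
      (e.trans (twistEquivWeightSubmodule hq hμ i))
    exact ⟨φ.symm⟩

theorem mainTheorem11 (k : Type u) [Field k] [IsAlgClosed k] [CharZero k]
    (q : kˣ) (hq : ∀ n : ℕ, 0 < n → q ^ n ≠ 1) :
    -- the support is a single orbit, and all weight spaces are infinite-dimensional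
    (∀ (V : Type v) [AddCommGroup V] [Module k V] [Module (Dq k q) V]
        [IsScalarTower k (Dq k q) V],
      IsSimpleModule (Dq k q) V → IsAWeight k q V →
        (supp k q V).Nonempty ∧
        ∀ μ ∈ supp k q V,
          supp k q V = Set.range (fun i : ℤ => q ^ i * μ) ∧
          ¬ FiniteDimensional k (weightSpace k q V μ)) ∧
    -- the two centralizers are isomorphic
    Nonempty (CA k q ≃ₐ[k] CK k q) ∧
    -- modules induced from simple modules are simple `a`-weight modules
    (∀ (M : Type v) [AddCommGroup M] [Module (CA k q) M],
      IsSimpleModule (CA k q) M →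
        IsSimpleModule (Dq k q) (Ind (CA k q) M) ∧ IsAWeight k q (Ind (CA k q) M)) ∧
    -- every simple `a`-weight module is induced from a simple module
    (∀ (V : Type v) [AddCommGroup V] [Module k V] [Module (Dq k q) V]
        [IsScalarTower k (Dq k q) V],
      IsSimpleModule (Dq k q) V → IsAWeight k q V →
        ∃ (M : Type v) (_ : AddCommGroup M) (_ : Module (CA k q) M),
          IsSimpleModule (CA k q) M ∧ Nonempty (Ind (CA k q) M ≃ₗ[Dq k q] V)) ∧
    -- two induced modules are isomorphic iff the modules differ by a twist by a power of `τ_K`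
    (∀ (M M' : Type v) [AddCommGroup M] [Module (CA k q) M] [AddCommGroup M']
        [Module (CA k q) M'],
      IsSimpleModule (CA k q) M → IsSimpleModule (CA k q) M' →
        (Nonempty (Ind (CA k q) M ≃ₗ[Dq k q] Ind (CA k q) M') ↔
          ∃ i : ℤ, Nonempty (M' ≃ₗ[CA k q] Twist (tauK k q ^ i) M))) :=
  mainTheorem11_general k q hq
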